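/- Let $n\ge 2$, $s=\frac{n-1}{2}$, $\hbar=2/\sqrt{n^2-1}$. Label the rows and columns of $n\times n$ matrices by $j=-s,-s+1,\dots,s$, and let $S_1,S_2,S_3\in\mathfrak{su}(n)$ be the spin matrices: $S_1$ is symmetric and $S_2$ antisymmetric, their only nonzero entries above the diagonal being $\frac i2\sqrt{s(s+1)-j(j+1)}$ and $\frac12\sqrt{s(s+1)-j(j+1)}$, respectively, at position $(j,j+1)$; and $S_3=\mathrm{diag}(ij)$. Let $\Delta_n P=\sum_{\alpha=1}^3[S_\alpha,[S_\alpha,P]]$ be the Hoppe–Yau Laplacian. The Zeitlin model is the Lie algebra $\mathfrak{su}(n)\times\mathfrak{u}(n)$ with bracket $$[(P_1,B_1),(P_2,B_2)]=\tfrac1\hbar\big([P_1,P_2],\ [P_1,B_2]+[B_1,P_2]-[P_1,P_2]\big)$$ and inner product $\langle(P_1,B_1),(P_2,B_2)\rangle=\operatorname{tr}(P_1\Delta_nP_2)-\operatorname{tr}(B_1B_2)$. Let $\mathrm{ad}_vw=-[v,w]$ and $\langle\mathrm{ad}^\star_vw,x\rangle=\langle w,\mathrm{ad}_vx\rangle$.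 As Lie group take $G=SU(n)\ltimes\mathfrak{u}(n)$, realised by the block matrices $\begin{pmatrix}g&0\\bg&g\end{pmatrix}$ with $g\in SU(n)$, $b\in\mathfrak u(n)$, where $(P,B)$ is identified with the element $-\frac1\hbar\begin{pmatrix}P&0\\B-P&P\end{pmatrix}$ of its Lie algebra (so that $\mathrm{ad}$ is the commutator of matrices), with the corresponding right-invariant metric. A geodesic $\gamma$ from the identity with Euler velocity field $v$ satisfies $\dot\gamma=v\gamma$, $\gamma(0)=e$, $\dot v+\mathrm{ad}^\star_vv=0$. A Jacobi field along it is $J=y\gamma$ with $\dot y-\mathrm{ad}_vy=z$, $\dot z+\mathrm{ad}^\star_vz+\mathrm{ad}^\star_zv=0$. For $T>0$, $\gamma(T)$ is conjugate to the identity if some nonzero Jacobi field vanishes at $0$ and $T$; its multiplicity is the real dimension of the space of Jacobi fields vanishing at $0$ and $T$. For integers $1\le m\le\ell$ let $W_{\ell,m}\subset\mathfrak{su}(n)$ be the space of all $X$ with $\Delta_nX=-\ell(\ell+1)X$ and $[S_3,[S_3,X]]=-m^2X$ (the span of the basis matrices $T_{\ell,m},T_{\ell,-m}$), and let $$K^-_{\ell,m}=\{(P,B)=(X,\ell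 X):X\in W_{\ell,m}\},\qquad K^+_{\ell,m}=\{(P,B)=(X,-(\ell+1)X):X\in W_{\ell,m}\}.$$ **Theorem.** There is a geodesic $\gamma$ from the identity with the constant Euler velocity field $P(t)=B(t)=\hbar S_3$, and for every such $\gamma$ the following holds. 1. For all positive integers $m,\ell,k$ with $m\le\ell\le\frac{n-1}{2}$, the points $\gamma(t)$ at the times $t=\frac{4\pi k\ell}{m}$ and $t=\frac{4\pi k(\ell+1)}{m}$ are conjugate to the identity along $\gamma$. In each case the pair $(\ell,m)$ contributes multiplicity exactly $2$: the space of Jacobi fields $J=y\gamma$ that vanish at the times $0$ and $t$ and have $y$ with values in $K^-_{\ell,m}$ (for $t=\frac{4\pi k\ell}{m}$), respectively in $K^+_{\ell,m}$ (for $t=\frac{4\pi k(\ell+1)}{m}$), has real dimension $2$. 2. The contributions of distinct pairs add up: for every $T>0$, the total multiplicity of $\gamma(T)$ is the sum, over all pairs of integers $1\le m\le\ell\le n-1$ and both signs, of the dimensions of the spaces of Jacobi fields $J=y\gamma$ that vanish at $0$ and $T$ and have $y$ with values in $K^\pm_{\ell,m}$. -/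

import Mathlib

open Matrix

attribute [local instance] Matrix.normedAddCommGroup Matrix.normedSpace

noncomputable section

namespace Zeitlin

/-- Complex `n × n` matrices. -/
abbrev Mat (n : ℕ) : Type := Matrix (Fin n) (Fin n) ℂ

/-- The Lie algebra `𝔲(n)` of skew-Hermitian matrices, as a real vector space. -/
def u (n : ℕ) : Submodule ℝ (Mat n) where
  carrier := {A | Aᴴ = -A}
  zero_mem' := by simp
  add_mem' := by
    intro A B hA hB
    simp only [Set.mem_ofPred_eq] at *
    rw [conjTranspose_add, hA, hB, neg_add]
  smul_mem' := by
    intro c A hA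
    simp only [Set.mem_ofPred_eq] at *
    rw [conjTranspose_smul, hA, star_trivial, smul_neg]

/-- The Lie algebra `𝔰𝔲(n)` of trace-free skew-Hermitian matrices, as a real vector space. -/
def su (n : ℕ) : Submodule ℝ (Mat n) where
  carrier := {A | Aᴴ = -A ∧ A.trace = 0}
  zero_mem' := by simp
  add_mem' := by
    rintro A B ⟨hA, hA'⟩ ⟨hB, hB'⟩
    refine ⟨?_, ?_⟩
    · rw [conjTranspose_add, hA, hB, neg_add]
    · rw [trace_add, hA', hB', add_zero]
  smul_mem' := by
    rintro c A ⟨hA, hA'⟩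
    refine ⟨?_, ?_⟩
    · rw [conjTranspose_smul, hA, star_trivial, smul_neg]
    · rw [trace_smul, hA', smul_zero]

lemma su_le_u (n : ℕ) : su n ≤ u n := fun _ h => h.1

/-- The matrix commutator `[A, B] = A B - B A`. -/
def comm {n : ℕ} (A B : Mat n) : Mat n := A * B - B * A

lemma comm_mem_su {n : ℕ} {A B : Mat n} (hA : A ∈ u n) (hB : B ∈ u n) : comm A B ∈ su n := by
  have hA' : Aᴴ = -A := hA
  have hB' : Bᴴ = -B := hB
  refine ⟨?_, ?_⟩
  · simp only [comm, conjTranspose_sub, conjTranspose_mul, hA', hB']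
    noncomm_ring
  · rw [comm, trace_sub, trace_mul_comm, sub_self]

/-- The spin `s = (n - 1) / 2`. -/
def spin (n : ℕ) : ℝ := ((n : ℝ) - 1) / 2

/-- The label `j ∈ {-s, …, s}` of the `i`-th row or column. -/
def label {n : ℕ} (i : Fin n) : ℝ := (i : ℕ) - spin n

/-- The number `√(s (s + 1) - j (j + 1))`, where `j` is the label of the row `i`. -/
def ladder {n : ℕ} (i : Fin n) : ℝ :=
  Real.sqrt (spin n * (spin n + 1) - label i * (label i + 1))

/-- `S₁`: symmetric, with entries `(i / 2) √(s (s + 1) - j (j + 1))` at `(j, j + 1)`. -/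
def S₁ (n : ℕ) : Mat n := Matrix.of fun a b =>
  if (a : ℕ) + 1 = b then Complex.I / 2 * (ladder a : ℂ)
  else if (b : ℕ) + 1 = a then Complex.I / 2 * (ladder b : ℂ) else 0

/-- `S₂`: antisymmetric, with entries `(1 / 2) √(s (s + 1) - j (j + 1))` at `(j, j + 1)`. -/
def S₂ (n : ℕ) : Mat n := Matrix.of fun a b =>
  if (a : ℕ) + 1 = b then 1 / 2 * (ladder a : ℂ)
  else if (b : ℕ) + 1 = a then -(1 / 2 * (ladder b : ℂ)) else 0

/-- `S₃`: diagonal, with entries `i j`. -/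
def S₃ (n : ℕ) : Mat n := Matrix.diagonal fun a => Complex.I * (label a : ℂ)

/-- The Hoppe–Yau Laplacian `Δₙ P = ∑ₐ [Sₐ, [Sₐ, P]]`. -/
def lap {n : ℕ} (P : Mat n) : Mat n :=
  comm (S₁ n) (comm (S₁ n) P) + comm (S₂ n) (comm (S₂ n) P) + comm (S₃ n) (comm (S₃ n) P)

/-- `ℏ = 2 / √(n² - 1)`. -/
def hbar (n : ℕ) : ℝ := 2 / Real.sqrt ((n : ℝ) ^ 2 - 1)

/-- The vector space `𝔰𝔲(n) × 𝔲(n)`, whose elements are the pairs `(P, B)`. -/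
abbrev Alg (n : ℕ) : Type := su n × u n

/-- The Lie bracket of the Abelian extension of `(𝔰𝔲(n), ℏ⁻¹[·,·])` by `𝔲(n)` with the action
`ρ(P) B = ℏ⁻¹ [P, B]` and the cocycle `b(P₁, P₂) = - ℏ⁻¹ [P₁, P₂]`:
`[(P₁, B₁), (P₂, B₂)] = (ℏ⁻¹ [P₁, P₂], ρ(P₁) B₂ - ρ(P₂) B₁ + b(P₁, P₂))`. -/
def bracket {n : ℕ} (v w : Alg n) : Alg n :=
  (⟨(hbar n)⁻¹ • comm v.1.1 w.1.1,
      (su n).smul_mem _ (comm_mem_su (su_le_u n v.1.2) (su_le_u n w.1.2))⟩,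
    ⟨(hbar n)⁻¹ • comm v.1.1 w.2.1 - (hbar n)⁻¹ • comm w.1.1 v.2.1
        + -((hbar n)⁻¹ • comm v.1.1 w.1.1),
      (u n).add_mem
        ((u n).sub_mem
          ((u n).smul_mem _ (su_le_u n (comm_mem_su (su_le_u n v.1.2) w.2.2)))
          ((u n).smul_mem _ (su_le_u n (comm_mem_su (su_le_u n w.1.2) v.2.2))))
        ((u n).neg_mem
          ((u n).smul_mem _ (su_le_u n (comm_mem_su (su_le_u n v.1.2) (su_le_u n w.1.2)))))⟩)

/-- The operator `ad`, which is the negative of the Lie bracket (the metric is right-invariant). -/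
def ad {n : ℕ} (v w : Alg n) : Alg n := -bracket v w

/-- The inner product `⟨(P₁, B₁), (P₂, B₂)⟩ = tr (P₁ Δₙ P₂) - tr (B₁ B₂)` (both traces are real). -/
def inn {n : ℕ} (v w : Alg n) : ℝ :=
  (trace (v.1.1 * lap w.1.1) - trace (v.2.1 * w.2.1)).re

/-- `a = ad⋆_v w`, that is, `⟨a, x⟩ = ⟨w, ad_v x⟩` for all `x`. -/
def IsAdStar {n : ℕ} (v w a : Alg n) : Prop := ∀ x, inn a x = inn w (ad v x)

/-- The Euler–Arnold equation `v' + ad⋆_v v = 0`. -/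
def IsEulerArnold {n : ℕ} (v : ℝ → Alg n) : Prop :=
  ∀ t, ∃ a, IsAdStar (v t) (v t) a ∧ HasDerivAt v (-a) t

/-- Complex `2n × 2n` matrices, in `n × n` blocks. -/
abbrev BMat (n : ℕ) : Type := Matrix (Fin n ⊕ Fin n) (Fin n ⊕ Fin n) ℂ

lemma star_specialUnitary {n : ℕ} {g : Mat n} (hg : g ∈ specialUnitaryGroup (Fin n) ℂ) :
    star g ∈ specialUnitaryGroup (Fin n) ℂ := by
  rw [mem_specialUnitaryGroup_iff] at hg ⊢
  refine ⟨Unitary.star_mem hg.1, ?_⟩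
  rw [star_eq_conjTranspose, det_conjTranspose, hg.2, star_one]

/-- The Lie group `SU(n) ⋉ 𝔲(n)` with the product `(g, b) (h, c) = (g h, b + g c g⁻¹)`, realised by
the invertible matrices with block rows `(g, 0)` and `(b g, g)`. -/
def group (n : ℕ) : Subgroup (BMat n)ˣ where
  carrier := {x | ∃ g ∈ specialUnitaryGroup (Fin n) ℂ, ∃ b ∈ u n,
    (x : BMat n) = fromBlocks g 0 (b * g) g}
  one_mem' := ⟨1, one_mem _, 0, zero_mem _, by simp⟩
  mul_mem' := by
    rintro x y ⟨g, hg, b, hb, hx⟩ ⟨h, hh, c, hc, hy⟩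
    have hg1 : star g * g = 1 := (mem_unitaryGroup_iff'.1 (mem_specialUnitaryGroup_iff.1 hg).1)
    refine ⟨g * h, mul_mem hg hh, b + g * c * star g, ?_, ?_⟩
    · refine (u n).add_mem hb ?_
      have hc' : cᴴ = -c := hc
      change (g * c * star g)ᴴ = -(g * c * star g)
      simp [star_eq_conjTranspose, conjTranspose_mul, hc', mul_assoc]
    · rw [Units.val_mul, hx, hy, fromBlocks_multiply]
      congr 1
      · simp
      · simp
      · have : g * c * star g * (g * h) = g * (c * h) := by
          calc g * c * star g * (g * h) = g * c * (star g * g) * h := by noncomm_ring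
            _ = g * (c * h) := by rw [hg1]; noncomm_ring
        rw [add_mul, this, mul_assoc]
      · simp
  inv_mem' := by
    rintro x ⟨g, hg, b, hb, hx⟩
    have hg1 : star g * g = 1 := (mem_unitaryGroup_iff'.1 (mem_specialUnitaryGroup_iff.1 hg).1)
    have hg2 : g * star g = 1 := (mem_unitaryGroup_iff.1 (mem_specialUnitaryGroup_iff.1 hg).1)
    refine ⟨star g, star_specialUnitary hg, -(star g * b * g), ?_, ?_⟩
    · refine (u n).neg_mem ?_
      have hb' : bᴴ = -b := hb
      change (star g * b * g)ᴴ = -(star g * b * g)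
      simp [star_eq_conjTranspose, conjTranspose_mul, hb', mul_assoc]
    · refine Units.inv_eq_of_mul_eq_one_right ?_
      rw [hx, fromBlocks_multiply]
      have h3 : b * g * star g + g * (-(star g * b * g) * star g) = 0 := by
        calc b * g * star g + g * (-(star g * b * g) * star g)
            = b * (g * star g) - (g * star g) * b * (g * star g) := by noncomm_ring
          _ = 0 := by rw [hg2]; simp
      rw [h3, hg2]
      simp

/-- The Lie algebra of `group n` consists of the matrices with block rows `(X, 0)` and `(Y, X)`, where
`X ∈ 𝔰𝔲(n)` and `Y ∈ 𝔲(n)`. This is the identification of `𝔰𝔲(n) × 𝔲(n)` with it that turns `ad`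
into the commutator of matrices, see `toLie_ad`. -/
def toLie {n : ℕ} (v : Alg n) : BMat n :=
  -((hbar n)⁻¹ • fromBlocks v.1.1 0 (v.2.1 - v.1.1) v.1.1)

lemma toLie_ad {n : ℕ} (v w : Alg n) :
    toLie (ad v w) = toLie v * toLie w - toLie w * toLie v := by
  simp only [toLie, ad, bracket, comm, Prod.fst_neg, Prod.snd_neg, NegMemClass.coe_neg, neg_mul_neg,
    smul_mul_smul_comm, fromBlocks_multiply, fromBlocks_smul, fromBlocks_neg, sub_eq_add_neg,
    fromBlocks_add]
  congr 1
  · simp; module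
  · simp
  · simp [mul_add, add_mul]; module
  · simp; module

lemma toLie_add {n : ℕ} (v w : Alg n) : toLie (v + w) = toLie v + toLie w := by
  simp only [toLie, Prod.fst_add, Prod.snd_add, Submodule.coe_add, ← neg_add, ← smul_add,
    fromBlocks_add]
  congr 3 <;> abel

lemma toLie_smul {n : ℕ} (c : ℝ) (v : Alg n) : toLie (c • v) = c • toLie v := by
  simp only [toLie, Prod.smul_fst, Prod.smul_snd, Submodule.coe_smul, ← smul_sub, smul_neg,
    smul_comm c (hbar n)⁻¹, fromBlocks_smul, smul_zero]

/-- `γ` is the geodesic of the right-invariant metric on `group n` that starts at the identity and has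
the Euler velocity field `v`: `γ' = v γ`, `γ 0 = e`, `v' + ad⋆_v v = 0`. -/
structure IsGeodesic {n : ℕ} (γ : ℝ → group n) (v : ℝ → Alg n) : Prop where
  start : γ 0 = 1
  flow : ∀ t, HasDerivAt (fun r => ((γ r : (BMat n)ˣ) : BMat n))
    (toLie (v t) * ((γ t : (BMat n)ˣ) : BMat n)) t
  euler : IsEulerArnold v

/-- The Jacobi equation for the right-translated field `y` along the geodesic with velocity field `v`:
`y' - ad_v y = z`, `z' + ad⋆_v z + ad⋆_z v = 0`. -/
def IsJacobiPair {n : ℕ} (v y z : ℝ → Alg n) : Prop :=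
  (∀ t, HasDerivAt y (ad (v t) (y t) + z t) t) ∧
  ∀ t, ∃ a b, IsAdStar (v t) (z t) a ∧ IsAdStar (z t) (v t) b ∧ HasDerivAt z (-(a + b)) t

lemma comm_add_right {n : ℕ} (A B C : Mat n) : comm A (B + C) = comm A B + comm A C := by
  simp only [comm]; noncomm_ring

lemma comm_add_left {n : ℕ} (A B C : Mat n) : comm (A + B) C = comm A C + comm B C := by
  simp only [comm]; noncomm_ring

lemma comm_smul_right {n : ℕ} (c : ℝ) (A B : Mat n) : comm A (c • B) = c • comm A B := by
  simp only [comm, mul_smul_comm, smul_mul_assoc, smul_sub]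

lemma comm_smul_left {n : ℕ} (c : ℝ) (A B : Mat n) : comm (c • A) B = c • comm A B := by
  simp only [comm, mul_smul_comm, smul_mul_assoc, smul_sub]

lemma lap_add {n : ℕ} (P Q : Mat n) : lap (P + Q) = lap P + lap Q := by
  simp only [lap, comm_add_right]; abel

lemma lap_smul {n : ℕ} (c : ℝ) (P : Mat n) : lap (c • P) = c • lap P := by
  simp only [lap, comm_smul_right, smul_add]

lemma bracket_add_right {n : ℕ} (v x y : Alg n) :
    bracket v (x + y) = bracket v x + bracket v y := by
  ext1 <;> apply Subtype.ext <;>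
    simp only [bracket, Prod.fst_add, Prod.snd_add, Submodule.coe_add, comm_add_right,
      comm_add_left] <;> module

lemma bracket_add_left {n : ℕ} (v x y : Alg n) :
    bracket (x + y) v = bracket x v + bracket y v := by
  ext1 <;> apply Subtype.ext <;>
    simp only [bracket, Prod.fst_add, Prod.snd_add, Submodule.coe_add, comm_add_right,
      comm_add_left] <;> module

lemma bracket_smul_right {n : ℕ} (c : ℝ) (v x : Alg n) :
    bracket v (c • x) = c • bracket v x := by
  ext1 <;> apply Subtype.ext <;>
    simp only [bracket, Prod.smul_fst, Prod.smul_snd, Submodule.coe_smul, comm_smul_right,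
      comm_smul_left] <;> module

lemma bracket_smul_left {n : ℕ} (c : ℝ) (v x : Alg n) :
    bracket (c • x) v = c • bracket x v := by
  ext1 <;> apply Subtype.ext <;>
    simp only [bracket, Prod.smul_fst, Prod.smul_snd, Submodule.coe_smul, comm_smul_right,
      comm_smul_left] <;> module

lemma ad_add_right {n : ℕ} (v x y : Alg n) : ad v (x + y) = ad v x + ad v y := by
  simp only [ad, bracket_add_right, neg_add]

lemma ad_add_left {n : ℕ} (v x y : Alg n) : ad (x + y) v = ad x v + ad y v := by
  simp only [ad, bracket_add_left, neg_add]

lemma ad_smul_right {n : ℕ} (c : ℝ) (v x : Alg n) : ad v (c • x) = c • ad v x := by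
  simp only [ad, bracket_smul_right, smul_neg]

lemma ad_smul_left {n : ℕ} (c : ℝ) (v x : Alg n) : ad (c • x) v = c • ad x v := by
  simp only [ad, bracket_smul_left, smul_neg]

lemma inn_add_left {n : ℕ} (x y w : Alg n) : inn (x + y) w = inn x w + inn y w := by
  simp only [inn, Prod.fst_add, Prod.snd_add, Submodule.coe_add, add_mul, trace_add,
    Complex.add_re, Complex.sub_re]
  ring

lemma inn_add_right {n : ℕ} (x y w : Alg n) : inn w (x + y) = inn w x + inn w y := by
  simp only [inn, Prod.fst_add, Prod.snd_add, Submodule.coe_add, mul_add, lap_add, trace_add,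
    Complex.add_re, Complex.sub_re]
  ring

lemma inn_smul_left {n : ℕ} (c : ℝ) (x w : Alg n) : inn (c • x) w = c * inn x w := by
  simp only [inn, Prod.smul_fst, Prod.smul_snd, Submodule.coe_smul, smul_mul_assoc, trace_smul,
    Complex.sub_re, Complex.smul_re, smul_eq_mul]
  ring

lemma inn_smul_right {n : ℕ} (c : ℝ) (x w : Alg n) : inn w (c • x) = c * inn w x := by
  simp only [inn, Prod.smul_fst, Prod.smul_snd, Submodule.coe_smul, mul_smul_comm, lap_smul,
    trace_smul, Complex.sub_re, Complex.smul_re, smul_eq_mul]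
  ring

lemma IsAdStar.add_right {n : ℕ} {v x y a b : Alg n} (ha : IsAdStar v x a) (hb : IsAdStar v y b) :
    IsAdStar v (x + y) (a + b) := fun w => by
  rw [inn_add_left, inn_add_left, ha w, hb w]

lemma IsAdStar.add_left {n : ℕ} {v x y a b : Alg n} (ha : IsAdStar x v a) (hb : IsAdStar y v b) :
    IsAdStar (x + y) v (a + b) := fun w => by
  rw [inn_add_left, ad_add_left, inn_add_right, ha w, hb w]

lemma IsAdStar.smul_right {n : ℕ} (c : ℝ) {v x a : Alg n} (ha : IsAdStar v x a) :
    IsAdStar v (c • x) (c • a) := fun w => by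
  rw [inn_smul_left, inn_smul_left, ha w]

lemma IsAdStar.smul_left {n : ℕ} (c : ℝ) {v x a : Alg n} (ha : IsAdStar x v a) :
    IsAdStar (c • x) v (c • a) := fun w => by
  rw [inn_smul_left, ad_smul_left, inn_smul_right, ha w]

/-- The real vector space of the Jacobi fields `J = y γ` along `γ` (with velocity field `v`) that
vanish at the times `0` and `T` and whose right-translated field `y` takes its values in `K`. -/
def vanishingJacobi {n : ℕ} (γ : ℝ → group n) (v : ℝ → Alg n) (T : ℝ)
    (K : Submodule ℝ (Alg n)) : Submodule ℝ (ℝ → BMat n) where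
  carrier := {J | J 0 = 0 ∧ J T = 0 ∧ ∃ y z : ℝ → Alg n, IsJacobiPair v y z ∧ (∀ t, y t ∈ K) ∧
    ∀ t, J t = toLie (y t) * ((γ t : (BMat n)ˣ) : BMat n)}
  zero_mem' := by
    refine ⟨rfl, rfl, 0, 0, ⟨fun t => ?_, fun t => ⟨0, 0, ?_, ?_, ?_⟩⟩, fun t => K.zero_mem,
      fun t => ?_⟩
    · have h : ad (v t) 0 + 0 = 0 := by simpa using ad_smul_right 0 (v t) 0
      exact (hasDerivAt_const t (0 : Alg n)).congr_deriv h.symm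
    · intro x; simp [inn]
    · intro x
      have h : ad 0 x = 0 := by simpa using ad_smul_left 0 x 0
      have h' : inn (v t) 0 = 0 := by simpa using inn_smul_right 0 0 (v t)
      have h2 : inn 0 x = 0 := by simpa using inn_smul_left 0 0 x
      exact h2.trans (by rw [← h', ← h]; rfl)
    · have h : (0 : Alg n) = -(0 + 0) := by simp
      exact (hasDerivAt_const t (0 : Alg n)).congr_deriv h
    · simp [toLie]
  add_mem' := by
    rintro J J' ⟨h0, hT, y, z, ⟨hy, hz⟩, hK, hJ⟩ ⟨h0', hT', y', z', ⟨hy', hz'⟩, hK', hJ'⟩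
    refine ⟨by simp [h0, h0'], by simp [hT, hT'], y + y', z + z', ⟨fun t => ?_, fun t => ?_⟩,
      fun t => K.add_mem (hK t) (hK' t), fun t => ?_⟩
    · have h : ad (v t) (y t) + z t + (ad (v t) (y' t) + z' t)
          = ad (v t) ((y + y') t) + (z + z') t := by
        simp only [Pi.add_apply, ad_add_right]; abel
      exact ((hy t).add (hy' t)).congr_deriv h
    · obtain ⟨a, b, ha, hb, h⟩ := hz t
      obtain ⟨a', b', ha', hb', h'⟩ := hz' t
      refine ⟨a + a', b + b', ha.add_right ha', hb.add_left hb', ?_⟩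
      have h2 : -(a + b) + -(a' + b') = -(a + a' + (b + b')) := by abel
      exact (h.add h').congr_deriv h2
    · simp only [Pi.add_apply, hJ t, hJ' t, toLie_add, add_mul]
  smul_mem' := by
    rintro c J ⟨h0, hT, y, z, ⟨hy, hz⟩, hK, hJ⟩
    refine ⟨by simp [h0], by simp [hT], c • y, c • z, ⟨fun t => ?_, fun t => ?_⟩,
      fun t => K.smul_mem c (hK t), fun t => ?_⟩
    · have h : c • (ad (v t) (y t) + z t) = ad (v t) ((c • y) t) + (c • z) t := by
        simp only [Pi.smul_apply, ad_smul_right, smul_add]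
      exact ((hy t).const_smul c).congr_deriv h
    · obtain ⟨a, b, ha, hb, h⟩ := hz t
      refine ⟨c • a, c • b, ha.smul_right c, hb.smul_left c, ?_⟩
      have h2 : c • -(a + b) = -(c • a + c • b) := by simp only [smul_neg, smul_add]
      exact (h.const_smul c).congr_deriv h2
    · simp only [Pi.smul_apply, hJ t, toLie_smul, smul_mul_assoc]

/-- The point `γ T` is conjugate to the identity along `γ`: some nonzero Jacobi field along `γ`
vanishes at the times `0` and `T > 0`. -/
def IsConjugate {n : ℕ} (γ : ℝ → group n) (v : ℝ → Alg n) (T : ℝ) : Prop :=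
  0 < T ∧ ∃ J ∈ vanishingJacobi γ v T ⊤, J ≠ 0

/-- The multiplicity of `γ T` as a conjugate point to the identity along `γ`. -/
def multiplicity {n : ℕ} (γ : ℝ → group n) (v : ℝ → Alg n) (T : ℝ) : ℕ :=
  Module.finrank ℝ (vanishingJacobi γ v T ⊤)

/-- The contribution to this multiplicity of the Jacobi fields with right-translated field in `K`. -/
def multiplicityIn {n : ℕ} (γ : ℝ → group n) (v : ℝ → Alg n) (T : ℝ)
    (K : Submodule ℝ (Alg n)) : ℕ :=
  Module.finrank ℝ (vanishingJacobi γ v T K)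

/-- For a pair `(ℓ, m)` and a real number `c`, the space of all `(X, c X)`, where `X ∈ 𝔰𝔲(n)` lies in
the span of the two basis matrices `T_{ℓ,m}` and `T_{ℓ,-m}`, that is, `Δₙ X = - ℓ (ℓ + 1) X` and
`[S₃, [S₃, X]] = - m² X`. -/
def block (n ℓ m : ℕ) (c : ℝ) : Submodule ℝ (Alg n) where
  carrier := {v | lap v.1.1 = (-((ℓ : ℝ) * (ℓ + 1))) • v.1.1 ∧
    comm (S₃ n) (comm (S₃ n) v.1.1) = (-((m : ℝ) ^ 2)) • v.1.1 ∧ v.2.1 = c • v.1.1}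
  zero_mem' := by simp [lap, comm]
  add_mem' := by
    rintro v w ⟨h1, h2, h3⟩ ⟨h1', h2', h3'⟩
    simp only [Set.mem_ofPred_eq, Prod.fst_add, Prod.snd_add, Submodule.coe_add, lap_add,
      comm_add_right, h1, h1', h2, h2', h3, h3', smul_add, and_self]
  smul_mem' := by
    rintro r v ⟨h1, h2, h3⟩
    simp only [Set.mem_ofPred_eq, Prod.smul_fst, Prod.smul_snd, Submodule.coe_smul, lap_smul,
      comm_smul_right, h1, h2, h3]
    exact ⟨smul_comm _ _ _, smul_comm _ _ _, smul_comm _ _ _⟩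

lemma sum_label (n : ℕ) : ∑ a : Fin n, label a = 0 := by
  have h : ∑ a : Fin n, ((a : ℕ) : ℝ) = (n : ℝ) * ((n : ℝ) - 1) / 2 := by
    rw [Fin.sum_univ_eq_sum_range (fun i => (i : ℝ)) n]
    induction n with
    | zero => simp
    | succ k ih => rw [Finset.sum_range_succ, ih]; push_cast; ring
  simp only [label, spin, Finset.sum_sub_distrib, h, Finset.sum_const, Finset.card_univ,
    Fintype.card_fin, nsmul_eq_mul]
  ring

lemma S₃_mem_su (n : ℕ) : S₃ n ∈ su n := by
  refine ⟨?_, ?_⟩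
  · rw [S₃, diagonal_conjTranspose, diagonal_neg]
    congr 1
    ext a; simp
  · rw [S₃, trace_diagonal, ← Finset.mul_sum, ← Complex.ofReal_sum, sum_label]
    simp

/-- The element `(P, B) = (ℏ S₃, ℏ S₃)` of `𝔰𝔲(n) × 𝔲(n)`. -/
def rot (n : ℕ) : Alg n :=
  (⟨hbar n • S₃ n, (su n).smul_mem _ (S₃_mem_su n)⟩,
    ⟨hbar n • S₃ n, (u n).smul_mem _ (su_le_u n (S₃_mem_su n))⟩)

end Zeitlin

end

noncomputable section

namespace Zeitlin

variable {n : ℕ}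

/-! Along a rotation about the third axis the Jacobi equation has constant coefficients and splits
into scalar equations. Write v for `rot n`. Both `ad v` and `ad⋆_v` act on P and B separately,
through `[S₃, ·]`. The operator w ↦ `ad⋆_w v` mixes P and B: its first component a satisfies Δ a =
[S₃, P + B], and its second one is -[S₃, P] (`isAdStar_rot_right`). On pairs (X, cX) with ΔX =
-ℓ(ℓ+1)X it is compatible with the ratio c exactly when c(c+1) = ℓ(ℓ+1), that is, for c = ℓ or c =
-(ℓ+1). This is where the two families of blocks come from. In a block of order m, with complex
coordinates η of y and ζ of z, the system reads η' = imη + ζ, ζ' = im(1 - 1/c)ζ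
(`hasDerivAt_coord`). Its solutions with η(0) = 0 are the complex multiples of exp(imt)(exp(-imt/c)
- 1), the `profile`. They vanish at T exactly when mT/c is a multiple of 2π, and the free complex
factor accounts for the multiplicity 2. For the total, the blocks must capture everything.
Representation theory of the spin matrices provides n² orthogonal joint eigenmatrices of Δ and [S₃,
·], so an element without block coordinates commutes with S₃ (`S₃_comm_eq_zero`). There the Jacobi
equation degenerates to y'' = 0, and a field vanishing at 0 and T ≠ 0 is zero
(`isJacobiPair_eq_zero`). -/

/-! ### Commutator identities and the trace form -/

lemma comm_neg_right (A B : Mat n) : comm A (-B) = -comm A B := by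
  simp only [comm]; noncomm_ring

lemma comm_sub_right (A B C : Mat n) : comm A (B - C) = comm A B - comm A C := by
  simp only [comm]; noncomm_ring

lemma comm_zero_right (A : Mat n) : comm A 0 = 0 := by simp [comm]

lemma comm_csmul_right (c : ℂ) (A B : Mat n) : comm A (c • B) = c • comm A B := by
  simp only [comm, mul_smul_comm, smul_mul_assoc, smul_sub]

lemma comm_csmul_left (c : ℂ) (A B : Mat n) : comm (c • A) B = c • comm A B := by
  simp only [comm, mul_smul_comm, smul_mul_assoc, smul_sub]

lemma comm_swap (A B : Mat n) : comm A B = -comm B A := by simp [comm]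

/-- The Jacobi identity. -/
lemma comm_comm (A B X : Mat n) :
    comm A (comm B X) = comm B (comm A X) + comm (comm A B) X := by
  simp only [comm]; noncomm_ring

lemma comm_mul_right (A B C : Mat n) : comm A (B * C) = comm A B * C + B * comm A C := by
  simp only [comm]; noncomm_ring

lemma trace_comm_mul (A B C : Mat n) : trace (comm A B * C) = trace (A * comm B C) := by
  simp only [comm, sub_mul, mul_sub, trace_sub]
  rw [mul_assoc, ← mul_assoc A C B, trace_mul_comm (A * C) B, mul_assoc B A C]

lemma trace_mul_comm_eq (A B C : Mat n) : trace (B * comm A C) = -trace (comm A B * C) := by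
  rw [comm_swap A B, neg_mul, trace_neg, neg_neg, trace_comm_mul]

/-- Hence conjugate transposition maps an eigenmatrix of `comm A` to one with the conjugate
eigenvalue: this is how weight m passes to weight -m. -/
lemma comm_conjTranspose {A : Mat n} (hA : A ∈ u n) (B : Mat n) :
    (comm A B)ᴴ = comm A Bᴴ := by
  have hA' : Aᴴ = -A := hA
  simp only [comm, conjTranspose_sub, conjTranspose_mul, hA']
  noncomm_ring

/-! ### Ladder operators and their commutation relations -/

lemma S₃_comm_apply (X : Mat n) (a b : Fin n) :
    comm (S₃ n) X a b = Complex.I * ((a : ℕ) - (b : ℕ) : ℂ) * X a b := by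
  simp only [comm, S₃, Matrix.sub_apply, diagonal_mul, mul_diagonal, label]
  push_cast; ring

/-- In the index counted from 0 the radicand factors into nonnegative terms, so the real square root
is genuine. It vanishes only in the last row. -/
lemma ladder_sq (i : Fin n) (h : (i : ℕ) + 1 ≤ n) :
    ladder i ^ 2 = ((n : ℝ) - 1 - (i : ℕ)) * ((i : ℕ) + 1) := by
  have h' : ((i : ℕ) : ℝ) + 1 ≤ n := by exact_mod_cast h
  have e : spin n * (spin n + 1) - label i * (label i + 1)
      = ((n : ℝ) - 1 - (i : ℕ)) * ((i : ℕ) + 1) := by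
    simp only [spin, label]; ring
  rw [ladder, e, Real.sq_sqrt]
  have : (0 : ℝ) ≤ n - 1 - (i : ℕ) := by linarith
  positivity

lemma ladder_ne_zero (i : Fin n) (h : (i : ℕ) + 1 < n) : ladder i ≠ 0 := by
  have h' : ((i : ℕ) : ℝ) + 1 < n := by exact_mod_cast h
  have e := ladder_sq i h.le
  intro h0
  rw [h0] at e
  have : (0 : ℝ) < ((n : ℝ) - 1 - (i : ℕ)) * ((i : ℕ) + 1) := by
    have : (0 : ℝ) < n - 1 - (i : ℕ) := by linarith
    positivity
  norm_num at e
  rcases e with e | e <;> linarith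

/-- The raising operator `S₁ + i S₂`. -/
def Sp (n : ℕ) : Mat n := S₁ n + Complex.I • S₂ n

/-- The lowering operator `S₁ - i S₂`. -/
def Sm (n : ℕ) : Mat n := S₁ n - Complex.I • S₂ n

lemma Sp_apply (a b : Fin n) :
    Sp n a b = if (a : ℕ) + 1 = b then Complex.I * (ladder a : ℂ) else 0 := by
  simp only [Sp, S₁, S₂, Matrix.add_apply, Matrix.smul_apply, of_apply, smul_eq_mul]
  split_ifs
  · ring
  · ring
  · simp

lemma Sm_apply (a b : Fin n) :
    Sm n a b = if (b : ℕ) + 1 = a then Complex.I * (ladder b : ℂ) else 0 := by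
  simp only [Sm, S₁, S₂, Matrix.sub_apply, Matrix.smul_apply, of_apply, smul_eq_mul]
  split_ifs
  · omega
  · ring
  · ring
  · simp

lemma Sp_mul_Sm (n : ℕ) :
    Sp n * Sm n = diagonal fun a : Fin n => -(((n : ℂ) - 1 - (a : ℕ)) * ((a : ℕ) + 1)) := by
  ext a b
  rw [mul_apply, diagonal_apply]
  simp only [Sp_apply, Sm_apply]
  by_cases ha : (a : ℕ) + 1 < n
  · rw [Finset.sum_eq_single ⟨a + 1, ha⟩]
    · by_cases hab : a = b
      · subst hab
        have h := ladder_sq a ha.le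
        have h' : (ladder a : ℂ) ^ 2 = ((n : ℂ) - 1 - (a : ℕ)) * ((a : ℕ) + 1) := by
          rw [← Complex.ofReal_pow, h]; push_cast; ring
        rw [← h']
        simp only [if_true]
        linear_combination (ladder a : ℂ) ^ 2 * Complex.I_sq
      · have : ¬ ((b : ℕ) + 1 = a + 1) := fun h => hab (Fin.ext (by omega))
        rw [if_neg this, mul_zero, if_neg hab]
    · intro c _ hc
      have : ¬ ((a : ℕ) + 1 = c) := fun h => hc (Fin.ext h.symm)
      simp [this]
    · simp
  -- The last row of `Sp` is zero, and there the factor n - 1 - a vanishes as well.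
  · have e : (a : ℕ) + 1 = n := by omega
    rw [Finset.sum_eq_zero]
    · have e' : ((n : ℂ) - 1 - (a : ℕ)) = 0 := by
        have : ((a : ℕ) : ℂ) + 1 = n := by exact_mod_cast e
        rw [← this]; ring
      simp [e']
    · intro c _
      have : ¬ ((a : ℕ) + 1 = c) := by omega
      simp [this]

lemma Sm_mul_Sp (n : ℕ) :
    Sm n * Sp n = diagonal fun a : Fin n => -(((n : ℂ) - (a : ℕ)) * (a : ℕ)) := by
  ext a b
  rw [mul_apply, diagonal_apply]
  simp only [Sp_apply, Sm_apply]
  by_cases ha : 0 < (a : ℕ)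
  · have hlt : (a : ℕ) - 1 < n := by omega
    rw [Finset.sum_eq_single ⟨a - 1, hlt⟩]
    · have e1 : (a : ℕ) - 1 + 1 = a := by omega
      by_cases hab : a = b
      · subst hab
        have h := ladder_sq (⟨a - 1, hlt⟩ : Fin n) (by simp only; omega)
        have h' : (ladder (⟨a - 1, hlt⟩ : Fin n) : ℂ) ^ 2 = ((n : ℂ) - (a : ℕ)) * (a : ℕ) := by
          rw [← Complex.ofReal_pow, h]
          have : (((a : ℕ) - 1 : ℕ) : ℂ) = (a : ℕ) - 1 := by
            rw [Nat.cast_sub (by omega)]; simp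
          push_cast [this]; ring
        rw [← h']
        simp only [e1, if_true]
        linear_combination (ladder (⟨a - 1, hlt⟩ : Fin n) : ℂ) ^ 2 * Complex.I_sq
      · have : ¬ ((a : ℕ) = b) := fun h => hab (Fin.ext h)
        simp [hab, e1, this]
    · intro c _ hc
      have : ¬ ((c : ℕ) + 1 = a) := fun h => hc (Fin.ext (by simp only; omega))
      simp [this]
    · simp
  · have e : (a : ℕ) = 0 := by omega
    rw [Finset.sum_eq_zero]
    · simp [e]
    · intro c _
      have : ¬ ((c : ℕ) + 1 = a) := by omega
      simp [this]

lemma comm_Sp_Sm (n : ℕ) : comm (Sp n) (Sm n) = (-2 * Complex.I) • S₃ n := by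
  rw [comm, Sp_mul_Sm, Sm_mul_Sp, S₃, diagonal_sub, ← diagonal_smul]
  congr 1
  ext a
  simp only [Pi.smul_apply, smul_eq_mul, label, spin]
  push_cast
  linear_combination (2 * (a : ℕ) - n + 1 : ℂ) * Complex.I_sq

lemma comm_S₃_Sp (n : ℕ) : comm (S₃ n) (Sp n) = -Complex.I • Sp n := by
  ext a b
  rw [S₃_comm_apply, Matrix.smul_apply, Sp_apply]
  split_ifs with h
  · rw [← h]; push_cast; simp only [smul_eq_mul]; ring
  · simp

lemma comm_S₃_Sm (n : ℕ) : comm (S₃ n) (Sm n) = Complex.I • Sm n := by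
  ext a b
  rw [S₃_comm_apply, Matrix.smul_apply, Sm_apply]
  split_ifs with h
  · rw [← h]; push_cast; simp only [smul_eq_mul]; ring
  · simp

lemma S₁_eq (n : ℕ) : S₁ n = (1 / 2 : ℂ) • (Sp n + Sm n) := by
  simp only [Sp, Sm]; module

lemma S₂_eq (n : ℕ) : S₂ n = (-Complex.I / 2) • (Sp n - Sm n) := by
  have : Sp n - Sm n = (2 * Complex.I) • S₂ n := by simp only [Sp, Sm]; module
  rw [this, smul_smul]
  have : -Complex.I / 2 * (2 * Complex.I) = 1 := by linear_combination -Complex.I_sq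
  rw [this, one_smul]

/-! ### The Laplacian as a Casimir operator -/

/-- The Laplacian in terms of the ladder operators. -/
lemma lap_eq_lower_raise (X : Mat n) :
    lap X = comm (Sm n) (comm (Sp n) X) - Complex.I • comm (S₃ n) X
      + comm (S₃ n) (comm (S₃ n) X) := by
  have h : comm (Sp n) (comm (Sm n) X) =
      comm (Sm n) (comm (Sp n) X) + (-2 * Complex.I) • comm (S₃ n) X := by
    rw [comm_comm, comm_Sp_Sm, comm_csmul_left]
  have h1 : comm (S₁ n) (comm (S₁ n) X) + comm (S₂ n) (comm (S₂ n) X) =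
      (1 / 2 : ℂ) • (comm (Sp n) (comm (Sm n) X) + comm (Sm n) (comm (Sp n) X)) := by
    have hI : (-Complex.I / 2) * (-Complex.I / 2) = -(1 / 4 : ℂ) := by
      linear_combination (1 / 4 : ℂ) * Complex.I_sq
    simp only [S₁_eq, S₂_eq, comm_csmul_left, comm_csmul_right, smul_smul, hI]
    simp only [sub_eq_add_neg, comm_add_left, comm_add_right]
    have hn : ∀ Y : Mat n, comm (-Sm n) Y = -comm (Sm n) Y := fun Y => by
      simp only [comm]; noncomm_ring
    simp only [hn, comm_neg_right]
    module
  rw [lap, h1, h]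
  module

/-- The form suited to matrices that lowering annihilates; it differs from `lap_eq_lower_raise` by
[S₊, S₋] = -2i S₃. -/
lemma lap_eq_raise_lower (X : Mat n) :
    lap X = comm (Sp n) (comm (Sm n) X) + Complex.I • comm (S₃ n) X
      + comm (S₃ n) (comm (S₃ n) X) := by
  have h : comm (Sp n) (comm (Sm n) X) =
      comm (Sm n) (comm (Sp n) X) + (-2 * Complex.I) • comm (S₃ n) X := by
    rw [comm_comm, comm_Sp_Sm, comm_csmul_left]
  rw [lap_eq_lower_raise, h]
  module

lemma lap_csmul (c : ℂ) (X : Mat n) : lap (c • X) = c • lap X := by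
  simp only [lap, comm_csmul_right, smul_add]

lemma lap_comm_S₃ (X : Mat n) : lap (comm (S₃ n) X) = comm (S₃ n) (lap X) := by
  have h : comm (S₃ n) (comm (Sm n) (comm (Sp n) X)) =
      comm (Sm n) (comm (Sp n) (comm (S₃ n) X)) := by
    rw [comm_comm, comm_comm (S₃ n) (Sp n), comm_S₃_Sm, comm_S₃_Sp]
    simp only [comm_csmul_left, comm_csmul_right, comm_add_right]
    module
  rw [lap_eq_lower_raise, lap_eq_lower_raise, comm_add_right, comm_sub_right, comm_csmul_right, h]

lemma lap_comm_Sm (X : Mat n) : lap (comm (Sm n) X) = comm (Sm n) (lap X) := by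
  have h3 : ∀ Y, comm (S₃ n) (comm (Sm n) Y) =
      comm (Sm n) (comm (S₃ n) Y) + Complex.I • comm (Sm n) Y := fun Y => by
    rw [comm_comm, comm_S₃_Sm, comm_csmul_left]
  -- With one form on each side the triple commutators coincide, and only terms in `S₃` remain to be
  -- compared.
  rw [lap_eq_lower_raise, lap_eq_raise_lower]
  simp only [h3, comm_add_right, comm_csmul_right, smul_add, smul_smul, Complex.I_mul_I]
  module

lemma S₁_mem_u (n : ℕ) : S₁ n ∈ u n := by
  change (S₁ n)ᴴ = -S₁ n
  ext a b
  rw [conjTranspose_apply, Matrix.neg_apply]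
  simp only [S₁, of_apply]
  split_ifs <;> first | omega | simp [neg_div]

lemma S₂_mem_u (n : ℕ) : S₂ n ∈ u n := by
  change (S₂ n)ᴴ = -S₂ n
  ext a b
  rw [conjTranspose_apply, Matrix.neg_apply]
  simp only [S₂, of_apply]
  split_ifs <;> first | omega | simp

lemma S₃_mem_u (n : ℕ) : S₃ n ∈ u n := su_le_u n (S₃_mem_su n)

lemma lap_mem_su {X : Mat n} (hX : X ∈ u n) : lap X ∈ su n := by
  have h : ∀ A ∈ u n, comm A (comm A X) ∈ su n := fun A hA =>
    comm_mem_su hA (su_le_u n (comm_mem_su hA hX))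
  exact (su n).add_mem ((su n).add_mem (h _ (S₁_mem_u n)) (h _ (S₂_mem_u n)))
    (h _ (S₃_mem_u n))

lemma lap_conjTranspose (X : Mat n) : (lap X)ᴴ = lap Xᴴ := by
  simp only [lap, conjTranspose_add, comm_conjTranspose (S₁_mem_u n),
    comm_conjTranspose (S₂_mem_u n), comm_conjTranspose (S₃_mem_u n)]

/-- Each commutator is skew for the trace form, so a double commutator is symmetric. -/
lemma trace_mul_lap (X Y : Mat n) : trace (X * lap Y) = trace (lap X * Y) := by
  simp only [lap, mul_add, add_mul, trace_add, trace_mul_comm_eq, neg_neg]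

lemma lap_S₃ (n : ℕ) : lap (S₃ n) = (-2 : ℝ) • S₃ n := by
  have h0 : comm (S₃ n) (S₃ n) = 0 := by simp [comm]
  have h1 : comm (Sm n) (Sp n) = (2 * Complex.I) • S₃ n := by
    rw [comm_swap, comm_Sp_Sm]; module
  rw [lap_eq_lower_raise, h0, comm_zero_right, comm_swap (Sp n), comm_S₃_Sp, neg_smul, neg_neg,
    comm_csmul_right, h1, smul_smul]
  have : Complex.I * (2 * Complex.I) = -2 := by linear_combination 2 * Complex.I_sq
  rw [this]
  ext a b; simp

open scoped ComplexOrder in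
lemma eq_zero_of_trace_star_mul_self {A : Mat n} (h : trace (Aᴴ * A) = 0) : A = 0 :=
  trace_conjTranspose_mul_self_eq_zero_iff.1 h

/-! ### Joint eigenmatrices by lowering from a highest weight -/

/-- `(ad Sm)ᵏ Spˡ`, a multiple of the basis matrix `T_{ℓ,ℓ-k}`. -/
def lowered (n ℓ : ℕ) : ℕ → Mat n
  | 0 => Sp n ^ ℓ
  | k + 1 => comm (Sm n) (lowered n ℓ k)

lemma comm_Sp_pow (ℓ : ℕ) : comm (Sp n) (Sp n ^ ℓ) = 0 := by
  rw [comm, ← pow_succ, ← pow_succ', sub_self]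

lemma S₃_comm_pow (ℓ : ℕ) : comm (S₃ n) (Sp n ^ ℓ) = (-Complex.I * ℓ) • Sp n ^ ℓ := by
  induction ℓ with
  | zero => simp [comm]
  | succ ℓ ih =>
    rw [pow_succ, comm_mul_right, ih, comm_S₃_Sp, smul_mul_assoc, mul_smul_comm, ← add_smul]
    push_cast; ring_nf

lemma S₃_comm_lowered (ℓ k : ℕ) :
    comm (S₃ n) (lowered n ℓ k) = (-Complex.I * (ℓ - k)) • lowered n ℓ k := by
  induction k with
  | zero => rw [lowered, S₃_comm_pow, Nat.cast_zero, sub_zero]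
  | succ k ih =>
    rw [lowered, comm_comm, ih, comm_S₃_Sm, comm_csmul_left, comm_csmul_right, ← add_smul]
    push_cast; ring_nf

/-- At the highest weight the raising term drops out and the terms in `S₃` give the eigenvalue;
lowering preserves it because it commutes with the Laplacian. -/
lemma lap_lowered (ℓ k : ℕ) :
    lap (lowered n ℓ k) = (-(ℓ * (ℓ + 1)) : ℂ) • lowered n ℓ k := by
  induction k with
  | zero =>
    rw [lowered, lap_eq_lower_raise, comm_Sp_pow, comm_zero_right, S₃_comm_pow, comm_csmul_right,
      S₃_comm_pow, smul_smul, smul_smul, zero_sub, ← neg_smul, ← add_smul]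
    congr 1
    linear_combination ((ℓ : ℂ) + ℓ ^ 2) * Complex.I_sq
  | succ k ih => rw [lowered, lap_comm_Sm, ih, comm_csmul_right]

lemma Sp_pow_apply_ne_zero (ℓ : ℕ) (a b : Fin n) (h : (a : ℕ) + ℓ = b) : (Sp n ^ ℓ) a b ≠ 0 := by
  induction ℓ generalizing b with
  | zero =>
    have : a = b := Fin.ext (by omega)
    simp [this]
  | succ ℓ ih =>
    have hc : (a : ℕ) + ℓ < n := by omega
    rw [pow_succ, mul_apply, Finset.sum_eq_single ⟨a + ℓ, hc⟩]
    · refine mul_ne_zero (ih _ rfl) ?_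
      rw [Sp_apply, if_pos (by simp only; omega)]
      refine mul_ne_zero Complex.I_ne_zero ?_
      exact_mod_cast ladder_ne_zero _ (by simp only; omega)
    · intro c _ hc
      have : ¬ ((c : ℕ) + 1 = b) := fun h' => hc (Fin.ext (by simp only; omega))
      rw [Sp_apply, if_neg this, mul_zero]
    · simp

lemma lowered_ne_zero {ℓ k : ℕ} (hℓ : ℓ < n) (hk : k ≤ ℓ) : lowered n ℓ k ≠ 0 := by
  induction k with
  | zero =>
    intro h
    refine Sp_pow_apply_ne_zero ℓ (⟨0, by omega⟩ : Fin n) ⟨ℓ, hℓ⟩ (by simp) ?_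
    rw [show Sp n ^ ℓ = 0 from h]; rfl
  | succ k ih =>
    intro h
    -- If lowering annihilated this matrix, of weight w = ℓ - k ≥ 1, the Laplacian would act by -w(w
    -- - 1) instead of -ℓ(ℓ + 1). With ℓ = k + d + 1 these differ by (k + 1)(2d + k + 2) > 0.
    have e := lap_eq_raise_lower (lowered n ℓ k)
    rw [show comm (Sm n) (lowered n ℓ k) = 0 from h, comm_zero_right, S₃_comm_lowered,
      comm_csmul_right, S₃_comm_lowered, lap_lowered, smul_smul, smul_smul, zero_add, ← add_smul,
      ← sub_eq_zero, ← sub_smul] at e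
    rcases smul_eq_zero.1 e with e | e
    · obtain ⟨d, rfl⟩ := Nat.exists_eq_add_of_lt hk
      have h4 : (((k + 1) * (2 * d + k + 2) : ℕ) : ℂ) = 0 := by
        push_cast at e ⊢
        linear_combination -e + (d + 1 - (d + 1) ^ 2 : ℂ) * Complex.I_sq
      rw [Nat.cast_eq_zero] at h4
      have : 0 < (k + 1) * (2 * d + k + 2) := by positivity
      omega
    · exact ih (by omega) e

/-- A multiple of the basis matrix `T_{ℓ,m}`, for `m ≤ ℓ`. -/
def harmonic (n ℓ m : ℕ) : Mat n := lowered n ℓ (ℓ - m)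

lemma S₃_comm_harmonic {ℓ m : ℕ} (h : m ≤ ℓ) :
    comm (S₃ n) (harmonic n ℓ m) = (-Complex.I * m) • harmonic n ℓ m := by
  rw [harmonic, S₃_comm_lowered, Nat.cast_sub h, sub_sub_cancel]

lemma lap_harmonic (ℓ m : ℕ) :
    lap (harmonic n ℓ m) = (-(ℓ * (ℓ + 1)) : ℂ) • harmonic n ℓ m := lap_lowered _ _

lemma harmonic_ne_zero {ℓ : ℕ} (hℓ : ℓ < n) (m : ℕ) : harmonic n ℓ m ≠ 0 :=
  lowered_ne_zero hℓ (Nat.sub_le _ _)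

/-- The pairing `tr (T_{ℓ,m}ᴴ X)`. -/
def pairing (n ℓ m : ℕ) : Mat n →ₗ[ℂ] ℂ where
  toFun X := trace ((harmonic n ℓ m)ᴴ * X)
  map_add' X Y := by rw [mul_add, trace_add]
  map_smul' c X := by rw [mul_smul_comm, trace_smul, RingHom.id_apply]

lemma pairing_apply (ℓ m : ℕ) (X : Mat n) :
    pairing n ℓ m X = trace ((harmonic n ℓ m)ᴴ * X) := rfl

lemma pairing_S₃_comm {ℓ m : ℕ} (h : m ≤ ℓ) (X : Mat n) :
    pairing n ℓ m (comm (S₃ n) X) = -Complex.I * m * pairing n ℓ m X := by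
  rw [pairing_apply, trace_mul_comm_eq, ← comm_conjTranspose (S₃_mem_u n), S₃_comm_harmonic h,
    conjTranspose_smul, smul_mul_assoc, trace_smul, pairing_apply]
  simp

lemma pairing_lap (ℓ m : ℕ) (X : Mat n) :
    pairing n ℓ m (lap X) = -(ℓ * (ℓ + 1)) * pairing n ℓ m X := by
  rw [pairing_apply, trace_mul_lap, ← lap_conjTranspose, lap_harmonic, conjTranspose_smul,
    smul_mul_assoc, trace_smul, pairing_apply]
  simp

lemma pairing_self_ne_zero {ℓ : ℕ} (hℓ : ℓ < n) (m : ℕ) :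
    pairing n ℓ m (harmonic n ℓ m) ≠ 0 := by
  rw [pairing_apply]
  exact fun h => harmonic_ne_zero hℓ m (eq_zero_of_trace_star_mul_self h)

lemma pairing_conjTranspose (ℓ m : ℕ) (X : Mat n) :
    trace (harmonic n ℓ m * X) = star (pairing n ℓ m Xᴴ) := by
  rw [pairing_apply, ← trace_conjTranspose, conjTranspose_mul, conjTranspose_conjTranspose,
    conjTranspose_conjTranspose, trace_mul_comm]

/-- The family of joint eigenmatrices of the Laplacian (with eigenvalue `-ℓ (ℓ + 1)`, where
`ℓ = max i j`) and `[S₃, ·]` (with eigenvalue `-i (j - i)`). -/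
def eigenbasis (n : ℕ) (p : Fin n × Fin n) : Mat n :=
  if p.1 ≤ p.2 then lowered n p.2 p.1 else (lowered n p.1 p.2)ᴴ

lemma eigenbasis_ne_zero (p : Fin n × Fin n) : eigenbasis n p ≠ 0 := by
  rw [eigenbasis]
  split_ifs with h
  · exact lowered_ne_zero p.2.2 h
  · rw [Ne, conjTranspose_eq_zero]
    exact lowered_ne_zero p.1.2 (not_le.1 h).le

lemma lap_eigenbasis (p : Fin n × Fin n) :
    lap (eigenbasis n p) =
      (-((max p.1 p.2 : ℕ) * ((max p.1 p.2 : ℕ) + 1) : ℝ)) • eigenbasis n p := by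
  rw [eigenbasis]
  split_ifs with h
  · rw [lap_lowered, max_eq_right (by exact_mod_cast h)]
    ext a b; simp
  · rw [← lap_conjTranspose, lap_lowered, max_eq_left (by exact_mod_cast (not_le.1 h).le),
      conjTranspose_smul]
    ext a b; simp

lemma S₃_comm_eigenbasis (p : Fin n × Fin n) :
    comm (S₃ n) (eigenbasis n p) =
      (-Complex.I * ((p.2 : ℕ) - (p.1 : ℕ))) • eigenbasis n p := by
  rw [eigenbasis]
  split_ifs with h
  · rw [S₃_comm_lowered]
  · rw [← comm_conjTranspose (S₃_mem_u n), S₃_comm_lowered, conjTranspose_smul]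
    congr 1
    simp only [star_mul', star_neg, Complex.star_def, Complex.conj_I, neg_neg, map_sub, map_natCast]
    ring

/-- The Laplacian is self-adjoint and `comm (S₃ n)` is skew-adjoint, and the pair of eigenvalues,
that is max i j and j - i, determines (i, j). -/
lemma eigenbasis_orthogonal {p q : Fin n × Fin n} (h : p ≠ q) :
    trace ((eigenbasis n p)ᴴ * eigenbasis n q) = 0 := by
  have h1 : trace ((eigenbasis n p)ᴴ * lap (eigenbasis n q)) =
      trace ((lap (eigenbasis n p))ᴴ * eigenbasis n q) := by
    rw [trace_mul_lap, lap_conjTranspose]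
  have h2 : trace ((eigenbasis n p)ᴴ * comm (S₃ n) (eigenbasis n q)) =
      -trace ((comm (S₃ n) (eigenbasis n p))ᴴ * eigenbasis n q) := by
    rw [trace_mul_comm_eq, comm_conjTranspose (S₃_mem_u n)]
  rw [lap_eigenbasis, lap_eigenbasis, conjTranspose_smul, mul_smul_comm, smul_mul_assoc,
    trace_smul, trace_smul, star_trivial, ← sub_eq_zero, ← sub_smul] at h1
  rw [S₃_comm_eigenbasis, S₃_comm_eigenbasis, conjTranspose_smul, mul_smul_comm, smul_mul_assoc,
    trace_smul, trace_smul, ← smul_neg, ← sub_eq_zero, smul_neg, ← neg_smul, ← sub_smul] at h2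
  rcases smul_eq_zero.1 h1 with h1 | h1
  · rcases smul_eq_zero.1 h2 with h2 | h2
    · refine absurd ?_ h
      simp only [star_mul', star_neg, Complex.star_def, Complex.conj_I, neg_neg, map_sub,
        map_natCast] at h2
      have h3 : Complex.I * (((q.2 : ℕ) : ℂ) + (p.1 : ℕ) - (((p.2 : ℕ) : ℂ) + (q.1 : ℕ))) = 0 := by
        linear_combination -h2
      have h4 := sub_eq_zero.1 ((mul_eq_zero.1 h3).resolve_left Complex.I_ne_zero)
      norm_cast at h4
      have h5 : (max (p.1 : ℕ) p.2 : ℕ) = max (q.1 : ℕ) q.2 := by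
        generalize max (p.1 : ℕ) p.2 = a at h1 ⊢
        generalize max (q.1 : ℕ) q.2 = b at h1 ⊢
        have : ((a : ℝ) - b) * (a + b + 1) = 0 := by linear_combination h1
        have h6 : ((a : ℝ) + b + 1) ≠ 0 := by positivity
        exact_mod_cast sub_eq_zero.1 ((mul_eq_zero.1 this).resolve_right h6)
      refine Prod.ext (Fin.ext ?_) (Fin.ext ?_) <;> omega
    · exact h2
  · exact h1

lemma linearIndependent_eigenbasis (n : ℕ) : LinearIndependent ℂ (eigenbasis n) := by
  rw [Fintype.linearIndependent_iff]
  intro g hg p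
  have h := congrArg (fun X => trace ((eigenbasis n p)ᴴ * X)) hg
  simp only [Finset.mul_sum, mul_smul_comm, trace_sum, trace_smul, mul_zero, trace_zero] at h
  rw [Finset.sum_eq_single p (fun q _ hq => by rw [eigenbasis_orthogonal hq.symm, smul_zero])
    (by simp)] at h
  rcases smul_eq_zero.1 h with h | h
  · exact h
  · exact absurd (eq_zero_of_trace_star_mul_self h) (eigenbasis_ne_zero p)

/-- There are n² members, orthogonal and nonzero, so they span all matrices. -/
lemma eq_zero_of_trace_eigenbasis {X : Mat n}
    (h : ∀ p, trace ((eigenbasis n p)ᴴ * X) = 0) : X = 0 := by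
  have hspan := (linearIndependent_eigenbasis n).span_eq_top_of_card_eq_finrank'
    (by simp [Module.finrank_matrix])
  have hX : X ∈ Submodule.span ℂ (Set.range (eigenbasis n)) := hspan ▸ Submodule.mem_top
  obtain ⟨c, hc⟩ := (Submodule.mem_span_range_iff_exists_fun ℂ).1 hX
  refine eq_zero_of_trace_star_mul_self ?_
  nth_rewrite 1 [← hc]
  simp only [conjTranspose_sum, conjTranspose_smul, Finset.sum_mul, smul_mul_assoc, trace_sum,
    trace_smul, h, smul_zero, Finset.sum_const_zero]

/-- The harmonics `T_{ℓ,m}` with `1 ≤ m ≤ ℓ < n` detect the off-diagonal part of a skew-Hermitian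
matrix. -/
lemma S₃_comm_eq_zero_of_pairing {X : Mat n} (hX : X ∈ u n)
    (h : ∀ ℓ m, 1 ≤ m → m ≤ ℓ → ℓ < n → pairing n ℓ m X = 0) : comm (S₃ n) X = 0 := by
  have key : ∀ {i j : Fin n}, i < j → lowered n j i = harmonic n j (j - i) := fun {i j} hij => by
    have : (i : ℕ) < j := hij
    rw [harmonic]; congr 1; omega
  have key' : ∀ {i j : Fin n}, i < j → pairing n j (j - i) X = 0 := fun {i j} hij => by
    have : (i : ℕ) < j := hij
    exact h _ _ (by omega) (by omega) j.2
  refine eq_zero_of_trace_eigenbasis fun p => ?_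
  rw [trace_mul_comm_eq, ← comm_conjTranspose (S₃_mem_u n), S₃_comm_eigenbasis,
    conjTranspose_smul, smul_mul_assoc, trace_smul, neg_eq_zero]
  -- Positive weights are covered by the hypothesis, weight zero is killed by `comm (S₃ n)`, and
  -- negative weights reduce to positive ones through Xᴴ = -X.
  rcases lt_trichotomy p.1 p.2 with hp | hp | hp
  · rw [eigenbasis, if_pos hp.le, key hp, ← pairing_apply, key' hp, smul_zero]
  · rw [hp]; simp
  · rw [eigenbasis, if_neg (not_le.2 hp), conjTranspose_conjTranspose, key hp,
      pairing_conjTranspose, show Xᴴ = -X from hX, map_neg, key' hp]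
    simp

/-! ### The operators ad and ad⋆ for the rotation field -/

lemma hbar_ne_zero (hn : 2 ≤ n) : hbar n ≠ 0 := by
  have h : (2 : ℝ) ≤ n := by exact_mod_cast hn
  have : 0 < Real.sqrt ((n : ℝ) ^ 2 - 1) := Real.sqrt_pos.2 (by nlinarith)
  rw [hbar]; positivity

/-- The Laplacian is injective on trace-free matrices. -/
lemma eq_zero_of_lap {X : Mat n} (hX : trace X = 0) (h : lap X = 0) : X = 0 := by
  refine eq_zero_of_trace_eigenbasis fun p => ?_
  have h1 : trace ((eigenbasis n p)ᴴ * lap X) = 0 := by rw [h, mul_zero, trace_zero]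
  rw [trace_mul_lap, ← lap_conjTranspose, lap_eigenbasis, conjTranspose_smul, smul_mul_assoc,
    trace_smul, star_trivial] at h1
  rcases smul_eq_zero.1 h1 with h2 | h2
  -- The eigenvalue is zero only for p = (0, 0), whose eigenmatrix is the identity; pairing with it
  -- is the trace.
  · have h3 : max (p.1 : ℕ) p.2 = 0 := by
      rw [neg_eq_zero, mul_eq_zero] at h2
      rcases h2 with h2 | h2
      · exact_mod_cast h2
      · exact absurd h2 (by positivity)
    have h4 : (p.1 : ℕ) = 0 := by omega
    have h5 : (p.2 : ℕ) = 0 := by omega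
    rw [eigenbasis, if_pos (Fin.le_def.2 (by omega)), h4, h5]
    simpa [lowered] using hX
  · exact h2

lemma eq_zero_of_re_trace_mul_self {X : Mat n} (hX : X ∈ u n) (h : (trace (X * X)).re = 0) :
    X = 0 := by
  have hX' : Xᴴ = -X := hX
  refine eq_zero_of_trace_star_mul_self (Complex.ext ?_ ?_)
  · rw [hX', neg_mul, trace_neg, Complex.neg_re, h, neg_zero, Complex.zero_re]
  · have : star (trace (Xᴴ * X)) = trace (Xᴴ * X) := by
      rw [← trace_conjTranspose, conjTranspose_mul, conjTranspose_conjTranspose]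
    exact Complex.conj_eq_iff_im.1 this

/-- The form is nondegenerate: testing with x = (Δa - G, 0) and x = (0, a' - H), where a and a' are
the two components, gives the squared norm of each error. Membership of G and H makes these test
vectors admissible. -/
lemma isAdStar_iff {v w a : Alg n} {G H : Mat n} (hG : G ∈ su n) (hH : H ∈ u n)
    (h : ∀ x : Alg n, inn w (ad v x) = (trace (G * x.1.1) - trace (H * x.2.1)).re) :
    IsAdStar v w a ↔ lap a.1.1 = G ∧ a.2.1 = H := by
  have e : ∀ x : Alg n, inn a x = (trace (lap a.1.1 * x.1.1) - trace (a.2.1 * x.2.1)).re :=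
    fun x => by rw [inn, trace_mul_lap]
  constructor
  · intro ha
    have hL : lap a.1.1 - G ∈ su n := (su n).sub_mem (lap_mem_su (su_le_u n a.1.2)) hG
    have hR : a.2.1 - H ∈ u n := (u n).sub_mem a.2.2 hH
    have key : ∀ x : Alg n,
        (trace ((lap a.1.1 - G) * x.1.1) - trace ((a.2.1 - H) * x.2.1)).re = 0 := fun x => by
      have := ha x
      rw [e, h] at this
      simp only [sub_mul, trace_sub, Complex.sub_re] at this ⊢
      linarith
    have h1 := key (⟨_, hL⟩, 0)
    have h2 := key (0, ⟨_, hR⟩)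
    simp only [ZeroMemClass.coe_zero, mul_zero, trace_zero, sub_zero, zero_sub, Complex.neg_re,
      neg_eq_zero] at h1 h2
    exact ⟨sub_eq_zero.1 (eq_zero_of_re_trace_mul_self (su_le_u n hL) h1),
      sub_eq_zero.1 (eq_zero_of_re_trace_mul_self hR h2)⟩
  · rintro ⟨h1, h2⟩ x
    rw [e, h, h1, h2]

lemma ad_rot_fst (hn : 2 ≤ n) (w : Alg n) : (ad (rot n) w).1.1 = -comm (S₃ n) w.1.1 := by
  simp only [ad, bracket, rot, Prod.fst_neg, NegMemClass.coe_neg, comm_smul_left, smul_smul,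
    inv_mul_cancel₀ (hbar_ne_zero hn), one_smul]

lemma ad_rot_snd (hn : 2 ≤ n) (w : Alg n) : (ad (rot n) w).2.1 = -comm (S₃ n) w.2.1 := by
  simp only [ad, bracket, rot, Prod.snd_neg, NegMemClass.coe_neg, comm_smul_left, comm_smul_right,
    smul_smul, inv_mul_cancel₀ (hbar_ne_zero hn), one_smul]
  rw [comm_swap w.1.1]
  abel

lemma isAdStar_rot_left (hn : 2 ≤ n) {w a : Alg n} :
    IsAdStar (rot n) w a ↔
      lap a.1.1 = lap (comm (S₃ n) w.1.1) ∧ a.2.1 = comm (S₃ n) w.2.1 := by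
  refine isAdStar_iff (lap_mem_su (su_le_u n (comm_mem_su (S₃_mem_u n) (su_le_u n w.1.2))))
    (su_le_u n (comm_mem_su (S₃_mem_u n) w.2.2)) fun x => ?_
  rw [inn, ad_rot_fst hn, ad_rot_snd hn, trace_mul_lap, mul_neg, mul_neg, trace_neg, trace_neg,
    trace_mul_comm_eq, trace_mul_comm_eq, neg_neg, neg_neg, lap_comm_S₃]

/-- Since Δ S₃ = -2 S₃, the metric weights the P-component of the rotation by 2; the cocycle -[P₁,
P₂] takes one of these two units away, leaving coefficient 1 on P + B. -/
lemma isAdStar_rot_right (hn : 2 ≤ n) {w a : Alg n} :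
    IsAdStar w (rot n) a ↔
      lap a.1.1 = comm (S₃ n) (w.1.1 + w.2.1) ∧ a.2.1 = -comm (S₃ n) w.1.1 := by
  refine isAdStar_iff (comm_mem_su (S₃_mem_u n) ((u n).add_mem (su_le_u n w.1.2) w.2.2))
    ((u n).neg_mem (su_le_u n (comm_mem_su (S₃_mem_u n) (su_le_u n w.1.2)))) fun x => ?_
  have h := hbar_ne_zero hn
  have hs : ∀ A B : Mat n, trace (S₃ n * comm A B) = trace (comm (S₃ n) A * B) := fun A B =>
    (trace_comm_mul _ _ _).symm
  have e1 : (rot n).1.1 = hbar n • S₃ n := rfl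
  have e2 : (rot n).2.1 = hbar n • S₃ n := rfl
  rw [inn, trace_mul_lap, e1, e2, lap_smul, lap_S₃]
  simp only [ad, bracket, Prod.fst_neg, Prod.snd_neg, NegMemClass.coe_neg]
  rw [comm_swap x.1.1]
  simp only [smul_neg, mul_neg, mul_add, mul_sub, neg_mul, add_mul, comm_add_right, trace_neg,
    trace_add, trace_sub, smul_mul_assoc, mul_smul_comm, smul_smul, trace_smul,
    hs, inv_mul_cancel₀ h, one_smul]
  simp only [Complex.sub_re, Complex.add_re, Complex.neg_re, Complex.smul_re, smul_eq_mul]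
  linear_combination 2 * (trace (comm (S₃ n) w.1.1 * x.1.1)).re * mul_inv_cancel₀ h

/-! ### Blocks and their coordinates -/

/-- The labels of the blocks: pairs `1 ≤ m ≤ ℓ ≤ n - 1` with a sign. -/
abbrev Idx (n : ℕ) : Type :=
  {p // p ∈ (Finset.Icc 1 (n - 1)).sigma fun ℓ => Finset.Icc 1 ℓ} × Bool

namespace Idx

/-- The degree `ℓ`. -/
def deg (i : Idx n) : ℕ := i.1.1.1

/-- The order `m`. -/
def ord (i : Idx n) : ℕ := i.1.1.2

/-- The constant `c` of the block: `ℓ` or `-(ℓ + 1)`. -/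
def const (i : Idx n) : ℝ := if i.2 then (i.deg : ℝ) else -((i.deg : ℝ) + 1)

lemma bounds (i : Idx n) : 1 ≤ i.ord ∧ i.ord ≤ i.deg ∧ i.deg < n := by
  have h := i.1.2
  rw [Finset.mem_sigma, Finset.mem_Icc, Finset.mem_Icc] at h
  change (1 ≤ i.deg ∧ i.deg ≤ n - 1) ∧ 1 ≤ i.ord ∧ i.ord ≤ i.deg at h
  omega

lemma exists_of_bounds {ℓ m : ℕ} (h1 : 1 ≤ m) (h2 : m ≤ ℓ) (h3 : ℓ < n) (s : Bool) :
    ∃ i : Idx n, i.deg = ℓ ∧ i.ord = m ∧ i.const = if s then (ℓ : ℝ) else -((ℓ : ℝ) + 1) := by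
  refine ⟨(⟨⟨ℓ, m⟩, ?_⟩, s), rfl, rfl, rfl⟩
  simp only [Finset.mem_sigma, Finset.mem_Icc]
  omega

lemma deg_pos (i : Idx n) : (1 : ℝ) ≤ i.deg := by
  have := i.bounds
  exact_mod_cast (by omega : 1 ≤ i.deg)

/-- The quadratic relation that makes the block invariant under w ↦ `ad⋆_w (rot n)`. -/
lemma const_mul (i : Idx n) : i.const * (i.const + 1) = i.deg * (i.deg + 1) := by
  rw [const]; split_ifs <;> ring

lemma const_ne_zero (i : Idx n) : i.const ≠ 0 := by
  have := i.deg_pos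
  rw [const]; split_ifs
  · linarith
  · intro h; linarith

lemma two_const_add_ne_zero (i : Idx n) : 2 * i.const + 1 ≠ 0 := by
  have := i.deg_pos
  rw [const]; split_ifs
  · linarith
  · intro h; linarith

lemma const_add_one_ne_zero (i : Idx n) : i.const + 1 ≠ 0 := fun h => by
  have h1 := i.const_mul
  have := i.deg_pos
  rw [h, mul_zero] at h1
  nlinarith

lemma ord_ne_zero (i : Idx n) : (i.ord : ℂ) ≠ 0 := by
  have := i.bounds
  exact_mod_cast (by omega : i.ord ≠ 0)

lemma ext_const {i j : Idx n} (h1 : i.deg = j.deg) (h2 : i.ord = j.ord)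
    (h3 : i.const = j.const) : i = j := by
  obtain ⟨⟨⟨a, b⟩, h⟩, s⟩ := i
  obtain ⟨⟨⟨a', b'⟩, h'⟩, s'⟩ := j
  obtain rfl : a = a' := h1
  obtain rfl : b = b' := h2
  have ha : (0 : ℝ) ≤ a := Nat.cast_nonneg a
  have : s = s' := by
    change (if s then (a : ℝ) else -((a : ℝ) + 1)) = if s' then (a : ℝ) else -((a : ℝ) + 1) at h3
    cases s <;> cases s' <;> simp at h3 ⊢ <;> linarith
  rw [this]

lemma const_eq_or {i j : Idx n} (h1 : i.deg = j.deg) (h : i.const ≠ j.const) :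
    i.const = -1 - j.const := by
  unfold const at *
  rw [h1] at h ⊢
  split_ifs at h ⊢ <;> first | exact absurd rfl h | ring

/-- The block with label `i`. -/
def blk (i : Idx n) : Submodule ℝ (Alg n) := block n i.deg i.ord i.const

/-- The coefficient of `T_{ℓ,m}`. -/
def coeff (i : Idx n) : Mat n →ₗ[ℂ] ℂ :=
  (pairing n i.deg i.ord (harmonic n i.deg i.ord))⁻¹ • pairing n i.deg i.ord

lemma coeff_S₃_comm (i : Idx n) (X : Mat n) :
    i.coeff (comm (S₃ n) X) = -Complex.I * i.ord * i.coeff X := by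
  simp only [coeff, LinearMap.smul_apply, smul_eq_mul, pairing_S₃_comm i.bounds.2.1]
  ring

lemma coeff_lap (i : Idx n) (X : Mat n) :
    i.coeff (lap X) = -(i.deg * (i.deg + 1)) * i.coeff X := by
  simp only [coeff, LinearMap.smul_apply, smul_eq_mul, pairing_lap]
  ring

lemma coeff_harmonic (i : Idx n) : i.coeff (harmonic n i.deg i.ord) = 1 := by
  simp only [coeff, LinearMap.smul_apply, smul_eq_mul]
  exact inv_mul_cancel₀ (pairing_self_ne_zero i.bounds.2.2 _)

lemma coeff_smul (i : Idx n) (r : ℝ) (X : Mat n) : i.coeff (r • X) = r * i.coeff X := by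
  rw [← Complex.coe_smul, map_smul, smul_eq_mul]

/-- The conjugate transpose has weight -m, and m ≠ 0. -/
lemma coeff_harmonic_conjTranspose (i : Idx n) : i.coeff (harmonic n i.deg i.ord)ᴴ = 0 := by
  have h := i.coeff_S₃_comm (harmonic n i.deg i.ord)ᴴ
  rw [← comm_conjTranspose (S₃_mem_u n), S₃_comm_harmonic i.bounds.2.1, conjTranspose_smul,
    map_smul, smul_eq_mul] at h
  simp only [star_mul', star_neg, Complex.star_def, Complex.conj_I, neg_neg, map_natCast] at h
  have h2 : 2 * Complex.I * i.ord * i.coeff (harmonic n i.deg i.ord)ᴴ = 0 := by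
    linear_combination h
  exact (mul_eq_zero.1 h2).resolve_left
    (mul_ne_zero (mul_ne_zero two_ne_zero Complex.I_ne_zero) i.ord_ne_zero)

/-- The coordinate of an element of the Lie algebra in the block with label `i`. -/
def coord (i : Idx n) : Alg n →ₗ[ℝ] ℂ where
  toFun v := (i.coeff v.2.1 + (1 + i.const) * i.coeff v.1.1) / (2 * i.const + 1)
  map_add' v w := by
    simp only [Prod.fst_add, Prod.snd_add, Submodule.coe_add, map_add]; ring
  map_smul' r v := by
    simp only [Prod.smul_fst, Prod.smul_snd, Submodule.coe_smul, coeff_smul, RingHom.id_apply,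
      Complex.real_smul]
    ring

lemma coord_apply (i : Idx n) (v : Alg n) :
    i.coord v = (i.coeff v.2.1 + (1 + i.const) * i.coeff v.1.1) / (2 * i.const + 1) := rfl

lemma two_const_add_ne_zero' (i : Idx n) : (2 * i.const + 1 : ℂ) ≠ 0 := by
  exact_mod_cast i.two_const_add_ne_zero

lemma const_ne_zero' (i : Idx n) : (i.const : ℂ) ≠ 0 := by exact_mod_cast i.const_ne_zero

lemma const_mul' (i : Idx n) : (i.const * (i.const + 1) : ℂ) = i.deg * (i.deg + 1) := by
  exact_mod_cast congrArg (fun x : ℝ => (x : ℂ)) i.const_mul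

/-- If all coordinates of an element vanish, then it commutes with `S₃`. -/
lemma S₃_comm_eq_zero {v : Alg n} (h : ∀ i : Idx n, i.coord v = 0) :
    comm (S₃ n) v.1.1 = 0 ∧ comm (S₃ n) v.2.1 = 0 := by
  have key : ∀ ℓ m, 1 ≤ m → m ≤ ℓ → ℓ < n →
      pairing n ℓ m v.1.1 = 0 ∧ pairing n ℓ m v.2.1 = 0 := by
    intro ℓ m h1 h2 h3
    have hc := pairing_self_ne_zero h3 m
    have hcoeff : ∀ i : Idx n, i.deg = ℓ → i.ord = m → ∀ X, pairing n ℓ m X =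
        pairing n ℓ m (harmonic n ℓ m) * i.coeff X := by
      rintro i rfl rfl X
      simp only [coeff, LinearMap.smul_apply, smul_eq_mul]
      rw [mul_inv_cancel_left₀ hc]
    have hz : ∀ i : Idx n, i.deg = ℓ → i.ord = m →
        pairing n ℓ m v.2.1 + (1 + i.const) * pairing n ℓ m v.1.1 = 0 := by
      intro i hi hi'
      have := h i
      rw [coord_apply, div_eq_zero_iff, or_iff_left i.two_const_add_ne_zero'] at this
      rw [hcoeff i hi hi', hcoeff i hi hi' v.1.1]
      linear_combination pairing n ℓ m (harmonic n ℓ m) * this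
    obtain ⟨i, hi, hi', hic⟩ := exists_of_bounds h1 h2 h3 true
    obtain ⟨j, hj, hj', hjc⟩ := exists_of_bounds h1 h2 h3 false
    have e1 := hz i hi hi'
    have e2 := hz j hj hj'
    rw [hic] at e1
    rw [hjc] at e2
    simp only [if_true, Bool.false_eq_true, if_false] at e1 e2
    push_cast at e1 e2
    -- The coordinates for both signs form a 2 × 2 system in the pairings of P and B, with
    -- determinant ±(2ℓ + 1).
    have h4 : (2 * ℓ + 1 : ℂ) * pairing n ℓ m v.1.1 = 0 := by linear_combination e1 - e2
    have h5 : (2 * ℓ + 1 : ℂ) ≠ 0 := by exact_mod_cast (by omega : 2 * ℓ + 1 ≠ 0)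
    have h6 := (mul_eq_zero.1 h4).resolve_left h5
    rw [h6] at e1
    exact ⟨h6, by linear_combination e1⟩
  exact ⟨S₃_comm_eq_zero_of_pairing (su_le_u n v.1.2) fun ℓ m h1 h2 h3 => (key ℓ m h1 h2 h3).1,
    S₃_comm_eq_zero_of_pairing v.2.2 fun ℓ m h1 h2 h3 => (key ℓ m h1 h2 h3).2⟩

/-- Different blocks have independent coordinates. -/
lemma coord_of_mem_blk {i j : Idx n} (hij : j ≠ i) {v : Alg n} (hv : v ∈ i.blk) :
    j.coord v = 0 := by
  obtain ⟨h1, h2, h3⟩ := hv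
  have e1 := congrArg j.coeff h1
  have e2 := congrArg j.coeff h2
  rw [coeff_lap, coeff_smul] at e1
  rw [coeff_S₃_comm, coeff_S₃_comm, coeff_smul] at e2
  rw [coord_apply, h3, coeff_smul]
  by_cases hf : j.coeff v.1.1 = 0
  · rw [hf]; simp
  have h4 : ((j.deg : ℂ) - i.deg) * (j.deg + i.deg + 1) = 0 := by
    push_cast at e1
    refine (mul_eq_zero.1 (?_ : _ * j.coeff v.1.1 = 0)).resolve_right hf
    linear_combination -e1
  have h5 : ((j.ord : ℂ) - i.ord) * (j.ord + i.ord) = 0 := by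
    push_cast at e2
    refine (mul_eq_zero.1 (?_ : _ * j.coeff v.1.1 = 0)).resolve_right hf
    linear_combination -e2 + (j.ord : ℂ) ^ 2 * j.coeff v.1.1 * Complex.I_sq
  have hdeg : j.deg = i.deg := by
    have : (j.deg + i.deg + 1 : ℂ) ≠ 0 := by exact_mod_cast (by omega : j.deg + i.deg + 1 ≠ 0)
    exact_mod_cast sub_eq_zero.1 ((mul_eq_zero.1 h4).resolve_right this)
  have hord : j.ord = i.ord := by
    have hb := j.bounds
    have : (j.ord + i.ord : ℂ) ≠ 0 := by exact_mod_cast (by omega : j.ord + i.ord ≠ 0)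
    exact_mod_cast sub_eq_zero.1 ((mul_eq_zero.1 h5).resolve_right this)
  -- Only the partner block of opposite sign is left. The two roots of c(c + 1) = ℓ(ℓ + 1) add up to
  -- -1, and the factor 1 + c in `coord` is chosen to annihilate the other root.
  have hc : i.const = -1 - j.const :=
    const_eq_or hdeg.symm fun hc => hij (ext_const hdeg hord hc.symm)
  rw [hc]
  push_cast; ring

/-- Without coordinates X commutes with S₃, whereas the double commutator multiplies X by -m² ≠ 0.
-/
lemma eq_zero_of_mem_blk {i : Idx n} {v : Alg n} (hv : v ∈ i.blk) (h : i.coord v = 0) :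
    v = 0 := by
  have h0 := (S₃_comm_eq_zero (v := v) fun j => by
    by_cases hj : j = i
    · rw [hj, h]
    · exact coord_of_mem_blk hj hv).1
  obtain ⟨-, h2, h3⟩ := hv
  rw [h0, comm_zero_right, eq_comm, smul_eq_zero] at h2
  have h1 : v.1.1 = 0 := by
    refine h2.resolve_left (neg_ne_zero.2 (pow_ne_zero 2 ?_))
    exact_mod_cast i.ord_ne_zero
  rw [h1, smul_zero] at h3
  exact Prod.ext (Subtype.ext h1) (Subtype.ext h3)

/-- The skew-Hermitian matrix with coefficient `x` of `T_{ℓ,m}`. -/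
def mat (i : Idx n) (x : ℂ) : Mat n :=
  x • harmonic n i.deg i.ord - (x • harmonic n i.deg i.ord)ᴴ

lemma S₃_comm_mat (i : Idx n) (x : ℂ) :
    comm (S₃ n) (i.mat x) = i.mat (-Complex.I * i.ord * x) := by
  rw [mat, comm_sub_right, ← comm_conjTranspose (S₃_mem_u n), comm_csmul_right,
    S₃_comm_harmonic i.bounds.2.1, smul_smul, mul_comm x, mat]

lemma mat_real_smul (i : Idx n) (r : ℝ) (x : ℂ) : i.mat (r * x) = r • i.mat x := by
  simp only [mat, mul_smul, Complex.coe_smul, conjTranspose_smul, star_trivial, smul_sub]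

lemma mat_add (i : Idx n) (x y : ℂ) : i.mat (x + y) = i.mat x + i.mat y := by
  simp only [mat, add_smul, conjTranspose_add]; abel

lemma lap_mat (i : Idx n) (x : ℂ) :
    lap (i.mat x) = (-((i.deg : ℝ) * (i.deg + 1))) • i.mat x := by
  have h : ∀ y, lap (y • harmonic n i.deg i.ord) =
      (-((i.deg : ℝ) * (i.deg + 1))) • y • harmonic n i.deg i.ord := fun y => by
    rw [lap_csmul, lap_harmonic, smul_comm, ← Complex.coe_smul]
    push_cast; rfl
  have hs : ∀ X Y : Mat n, lap (X - Y) = lap X - lap Y := fun X Y => by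
    rw [sub_eq_add_neg, lap_add, ← neg_one_smul ℝ Y, lap_smul]; module
  rw [mat, hs, ← lap_conjTranspose, h, conjTranspose_smul, star_trivial, smul_sub]

lemma mat_mem_su (i : Idx n) (x : ℂ) : i.mat x ∈ su n := by
  have h : ∀ y, i.mat y ∈ u n := fun y => by
    change (i.mat y)ᴴ = -i.mat y
    rw [mat, conjTranspose_sub, conjTranspose_conjTranspose, neg_sub]
  -- A matrix of nonzero weight is itself a commutator with `S₃`, hence trace-free.
  have e : i.mat x = comm (S₃ n) (i.mat (Complex.I / i.ord * x)) := by
    rw [S₃_comm_mat]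
    congr 1
    have := i.ord_ne_zero
    field_simp
    rw [Complex.I_sq]; ring
  rw [e]
  exact comm_mem_su (S₃_mem_u n) (h _)

/-- The element of the block with label `i` that has the coordinate `x`. -/
def embed (i : Idx n) : ℂ →ₗ[ℝ] Alg n where
  toFun x := (⟨i.mat x, i.mat_mem_su x⟩, ⟨i.const • i.mat x,
    (u n).smul_mem _ (su_le_u n (i.mat_mem_su x))⟩)
  map_add' x y := by
    ext1 <;> apply Subtype.ext <;> simp [mat_add]
  map_smul' r x := by
    ext1 <;> apply Subtype.ext <;> simp [mat_real_smul, smul_comm i.const r]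

lemma embed_fst (i : Idx n) (x : ℂ) : (i.embed x).1.1 = i.mat x := rfl

lemma embed_snd (i : Idx n) (x : ℂ) : (i.embed x).2.1 = i.const • i.mat x := rfl

lemma embed_mem (i : Idx n) (x : ℂ) : i.embed x ∈ i.blk := by
  refine ⟨i.lap_mat x, ?_, rfl⟩
  rw [embed_fst, S₃_comm_mat, S₃_comm_mat, ← mat_real_smul]
  congr 1
  push_cast
  linear_combination (i.ord : ℂ) ^ 2 * x * Complex.I_sq

lemma coord_embed (i : Idx n) (x : ℂ) : i.coord (i.embed x) = x := by
  have h : i.coeff (i.mat x) = x := by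
    rw [mat, map_sub, conjTranspose_smul, map_smul, map_smul, coeff_harmonic,
      coeff_harmonic_conjTranspose]
    simp
  rw [coord_apply, embed_fst, embed_snd, coeff_smul, h, div_eq_iff i.two_const_add_ne_zero']
  ring

lemma embed_coord {i : Idx n} {v : Alg n} (hv : v ∈ i.blk) : i.embed (i.coord v) = v := by
  refine sub_eq_zero.1 (eq_zero_of_mem_blk (i := i) (i.blk.sub_mem (i.embed_mem _) hv) ?_)
  rw [map_sub, coord_embed, sub_self]

end Idx

/-! ### Scalar linear differential equations -/

lemma hasDerivAt_linearMap (f : Alg n →ₗ[ℝ] ℂ) {y : ℝ → Alg n} {y' : Alg n} {t : ℝ}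
    (h : HasDerivAt y y' t) : HasDerivAt (fun r => f (y r)) (f y') t :=
  (LinearMap.toContinuousLinearMap f).hasFDerivAt.comp_hasDerivAt t h

lemma hasDerivAt_linearMap' (f : ℂ →ₗ[ℝ] Alg n) {y : ℝ → ℂ} {y' : ℂ} {t : ℝ}
    (h : HasDerivAt y y' t) : HasDerivAt (fun r => f (y r)) (f y') t :=
  (LinearMap.toContinuousLinearMap f).hasFDerivAt.comp_hasDerivAt t h

lemma hasDerivAt_cexp_mul (κ : ℂ) (t : ℝ) :
    HasDerivAt (fun r : ℝ => Complex.exp (κ * r)) (κ * Complex.exp (κ * t)) t := by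
  have h := ((hasDerivAt_id t).ofReal_comp.const_mul κ).cexp
  simpa [mul_comm] using h

/-- Multiplying by the integrating factor exp(-κt) gives a constant function. -/
lemma eq_mul_cexp {f : ℝ → ℂ} {κ : ℂ} (h : ∀ t, HasDerivAt f (κ * f t) t) (t : ℝ) :
    f t = f 0 * Complex.exp (κ * t) := by
  have hd : ∀ r, HasDerivAt (fun r : ℝ => f r * Complex.exp (-κ * r)) 0 r := fun r => by
    refine ((h r).mul (hasDerivAt_cexp_mul (-κ) r)).congr_deriv ?_
    ring
  have hc := is_const_of_deriv_eq_zero (fun r => (hd r).differentiableAt)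
    (fun r => (hd r).deriv) t 0
  simp only [Complex.ofReal_zero, mul_zero, Complex.exp_zero, mul_one] at hc
  rw [← hc, mul_assoc, ← Complex.exp_add]
  simp

/-! ### The Jacobi equation inside one block -/

namespace Idx

lemma coord_ad_rot (hn : 2 ≤ n) (i : Idx n) (w : Alg n) :
    i.coord (ad (rot n) w) = Complex.I * i.ord * i.coord w := by
  rw [coord_apply, ad_rot_fst hn, ad_rot_snd hn, map_neg, map_neg, coeff_S₃_comm, coeff_S₃_comm,
    coord_apply]
  ring

lemma deg_mul_ne_zero (i : Idx n) : ((i.deg : ℂ) * (i.deg + 1)) ≠ 0 := by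
  have := i.bounds
  have : i.deg ≠ 0 := by omega
  exact_mod_cast mul_ne_zero this (Nat.succ_ne_zero i.deg)

lemma const_add_one_ne_zero' (i : Idx n) : (i.const + 1 : ℂ) ≠ 0 := by
  exact_mod_cast i.const_add_one_ne_zero

lemma coord_of_isAdStar_rot_left (hn : 2 ≤ n) (i : Idx n) {w a : Alg n}
    (h : IsAdStar (rot n) w a) : i.coord a = -Complex.I * i.ord * i.coord w := by
  obtain ⟨h1, h2⟩ := (isAdStar_rot_left hn).1 h
  have e := congrArg i.coeff h1
  rw [coeff_lap, coeff_lap, coeff_S₃_comm] at e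
  have e' := mul_left_cancel₀ (neg_ne_zero.2 i.deg_mul_ne_zero) e
  rw [coord_apply, e', h2, coeff_S₃_comm, coord_apply]
  ring

/-- With p, q the coefficients of P and B, those of b satisfy (1 + c)b₁ = im(p + q)/c and b₂ = imp.
They add up to (im/c)(q + (1 + c)p), so `coord` is an eigenfunctional. -/
lemma coord_of_isAdStar_rot_right (hn : 2 ≤ n) (i : Idx n) {w b : Alg n}
    (h : IsAdStar w (rot n) b) : i.coord b = Complex.I * i.ord / i.const * i.coord w := by
  obtain ⟨h1, h2⟩ := (isAdStar_rot_right hn).1 h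
  have e := congrArg i.coeff h1
  rw [coeff_lap, coeff_S₃_comm, map_add, ← i.const_mul'] at e
  have hc := i.const_ne_zero'
  have hc1 := i.const_add_one_ne_zero'
  have hc2 := i.two_const_add_ne_zero'
  have e' : (1 + i.const) * i.coeff b.1.1 =
      Complex.I * i.ord / i.const * (i.coeff w.1.1 + i.coeff w.2.1) := by
    rw [div_mul_eq_mul_div, eq_div_iff hc]
    linear_combination -e
  rw [coord_apply, e', h2, map_neg, coeff_S₃_comm, coord_apply]
  field_simp
  ring

/-- The coordinates of a Jacobi field satisfy scalar differential equations. -/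
lemma hasDerivAt_coord (hn : 2 ≤ n) (i : Idx n) {y z : ℝ → Alg n}
    (h : IsJacobiPair (fun _ => rot n) y z) (t : ℝ) :
    HasDerivAt (fun r => i.coord (y r))
      (Complex.I * i.ord * i.coord (y t) + i.coord (z t)) t ∧
    HasDerivAt (fun r => i.coord (z r))
      (Complex.I * i.ord * (1 - 1 / i.const) * i.coord (z t)) t := by
  obtain ⟨a, b, ha, hb, hz⟩ := h.2 t
  refine ⟨(hasDerivAt_linearMap i.coord (h.1 t)).congr_deriv ?_,
    (hasDerivAt_linearMap i.coord hz).congr_deriv ?_⟩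
  · rw [map_add, coord_ad_rot hn]
  · rw [map_neg, map_add, coord_of_isAdStar_rot_left hn i ha, coord_of_isAdStar_rot_right hn i hb]
    ring

lemma isAdStar_rot_left_embed (hn : 2 ≤ n) (i : Idx n) (x : ℂ) :
    IsAdStar (rot n) (i.embed x) (i.embed (-Complex.I * i.ord * x)) := by
  rw [isAdStar_rot_left hn]
  simp only [embed_fst, embed_snd, comm_smul_right, S₃_comm_mat, and_self]

lemma isAdStar_rot_right_embed (hn : 2 ≤ n) (i : Idx n) (x : ℂ) :
    IsAdStar (i.embed x) (rot n) (i.embed (Complex.I * i.ord / i.const * x)) := by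
  have hc := i.const_ne_zero
  have hr : i.mat (Complex.I * i.ord / i.const * x) =
      (-(i.const)⁻¹) • i.mat (-Complex.I * i.ord * x) := by
    rw [← mat_real_smul]
    congr 1
    push_cast
    ring
  have h1 : (i.mat x) + i.const • i.mat x = (1 + i.const) • i.mat x := by module
  rw [isAdStar_rot_right hn]
  simp only [embed_fst, embed_snd]
  rw [lap_mat, h1, comm_smul_right, S₃_comm_mat, hr, smul_smul, smul_smul, ← i.const_mul]
  constructor
  · congr 1
    field_simp
    ring
  · rw [mul_neg, mul_inv_cancel₀ hc, neg_one_smul]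

lemma isJacobiPair_embed (hn : 2 ≤ n) (i : Idx n) {η ζ : ℝ → ℂ}
    (hη : ∀ t, HasDerivAt η (Complex.I * i.ord * η t + ζ t) t)
    (hζ : ∀ t, HasDerivAt ζ (Complex.I * i.ord * (1 - 1 / i.const) * ζ t) t) :
    IsJacobiPair (fun _ => rot n) (fun t => i.embed (η t)) (fun t => i.embed (ζ t)) := by
  refine ⟨fun t => ?_, fun t => ⟨_, _, i.isAdStar_rot_left_embed hn _,
    i.isAdStar_rot_right_embed hn _, ?_⟩⟩
  · refine (hasDerivAt_linearMap' i.embed (hη t)).congr_deriv ?_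
    rw [map_add]
    congr 1
    have hneg : ∀ x, i.mat (-x) = -i.mat x := fun x => by
      simpa using i.mat_real_smul (-1) x
    refine Prod.ext (Subtype.ext ?_) (Subtype.ext ?_)
    · rw [ad_rot_fst hn, embed_fst, embed_fst, S₃_comm_mat, ← hneg]
      congr 1; ring
    · rw [ad_rot_snd hn, embed_snd, embed_snd, comm_smul_right, S₃_comm_mat, ← smul_neg, ← hneg]
      congr 2; ring
  · refine (hasDerivAt_linearMap' i.embed (hζ t)).congr_deriv ?_
    rw [← map_add, ← map_neg]
    congr 1
    ring

/-- The time dependence of the coordinate of a Jacobi field that vanishes at the time `0`. -/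
def profile (i : Idx n) (t : ℝ) : ℂ :=
  Complex.exp (Complex.I * i.ord * t) * (Complex.exp (-(Complex.I * i.ord / i.const) * t) - 1)

lemma profile_zero (i : Idx n) : i.profile 0 = 0 := by simp [profile]

lemma profile_eq_zero_iff (i : Idx n) (t : ℝ) :
    i.profile t = 0 ↔ Complex.exp (-(Complex.I * i.ord / i.const) * t) = 1 := by
  rw [profile, mul_eq_zero, or_iff_right (Complex.exp_ne_zero _), sub_eq_zero]

lemma hasDerivAt_profile (i : Idx n) (t : ℝ) :
    HasDerivAt i.profile (Complex.I * i.ord * i.profile t +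
      -(Complex.I * i.ord / i.const) *
        Complex.exp (Complex.I * i.ord * (1 - 1 / i.const) * t)) t := by
  refine ((hasDerivAt_cexp_mul (Complex.I * i.ord) t).mul
    ((hasDerivAt_cexp_mul (-(Complex.I * i.ord / i.const)) t).sub_const 1)).congr_deriv ?_
  have : Complex.exp (Complex.I * i.ord * (1 - 1 / i.const) * t) =
      Complex.exp (Complex.I * i.ord * t) * Complex.exp (-(Complex.I * i.ord / i.const) * t) := by
    rw [← Complex.exp_add]; congr 1; ring
  rw [this, profile]
  ring

/-- The Jacobi fields in the block with label `i` that vanish at the time `0`. -/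
def field (i : Idx n) (γ : ℝ → group n) : ℂ →ₗ[ℝ] (ℝ → BMat n) where
  toFun x t := toLie (i.embed (x * i.profile t)) * ((γ t : (BMat n)ˣ) : BMat n)
  map_add' x y := by
    ext1 t
    rw [Pi.add_apply, add_mul, map_add, toLie_add, add_mul]
  map_smul' r x := by
    ext1 t
    rw [Pi.smul_apply, smul_mul_assoc, map_smul, toLie_smul, smul_mul_assoc, RingHom.id_apply]

lemma field_apply (i : Idx n) (γ : ℝ → group n) (x : ℂ) (t : ℝ) :
    i.field γ x t = toLie (i.embed (x * i.profile t)) * ((γ t : (BMat n)ˣ) : BMat n) := rfl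

lemma field_mem (hn : 2 ≤ n) (i : Idx n) (γ : ℝ → group n) {T : ℝ} {x : ℂ}
    (h : x * i.profile T = 0) :
    i.field γ x ∈ vanishingJacobi γ (fun _ => rot n) T i.blk := by
  have h0 : toLie (0 : Alg n) = 0 := by simpa using toLie_smul 0 (0 : Alg n)
  refine ⟨?_, ?_, _, _, i.isJacobiPair_embed hn (η := fun t => x * i.profile t)
    (ζ := fun t => x * (-(Complex.I * i.ord / i.const) *
      Complex.exp (Complex.I * i.ord * (1 - 1 / i.const) * t))) (fun t => ?_) (fun t => ?_),
    fun t => i.embed_mem _, fun t => rfl⟩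
  · rw [field_apply, profile_zero, mul_zero, map_zero, h0, zero_mul]
  · rw [field_apply, h, map_zero, h0, zero_mul]
  · refine ((i.hasDerivAt_profile t).const_mul x).congr_deriv ?_
    ring
  · refine (((hasDerivAt_cexp_mul (Complex.I * i.ord * (1 - 1 / i.const)) t).const_mul
      (-(Complex.I * i.ord / i.const))).const_mul x).congr_deriv ?_
    ring

lemma exists_coord_eq (hn : 2 ≤ n) (i : Idx n) {y z : ℝ → Alg n}
    (h : IsJacobiPair (fun _ => rot n) y z) (h0 : y 0 = 0) :
    ∃ x : ℂ, ∀ t, i.coord (y t) = x * i.profile t := by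
  set κ : ℂ := -(Complex.I * i.ord / i.const) with hκ
  have hκ0 : κ ≠ 0 :=
    neg_ne_zero.2 (div_ne_zero (mul_ne_zero Complex.I_ne_zero i.ord_ne_zero) i.const_ne_zero')
  have hz := eq_mul_cexp fun t => (i.hasDerivAt_coord hn h t).2
  -- The forcing term of `profile` starts at κ, so this multiple matches z at time 0. The difference
  -- then solves the homogeneous equation with initial value zero.
  refine ⟨i.coord (z 0) / κ, fun t => ?_⟩
  have hd := eq_mul_cexp (κ := Complex.I * i.ord)
    (f := fun t => i.coord (y t) - i.coord (z 0) / κ * i.profile t) (fun t => by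
      refine ((i.hasDerivAt_coord hn h t).1.sub
        ((i.hasDerivAt_profile t).const_mul (i.coord (z 0) / κ))).congr_deriv ?_
      rw [hz t, ← hκ]
      field_simp
      ring) t
  rw [h0, profile_zero, map_zero, mul_zero, sub_zero, zero_mul] at hd
  exact sub_eq_zero.1 hd

end Idx

/-! ### Decomposition of the vanishing Jacobi fields into blocks -/

lemma toLie_mul_eq_zero (hn : 2 ≤ n) {v : Alg n} (g : group n)
    (h : toLie v * ((g : (BMat n)ˣ) : BMat n) = 0) : v = 0 := by
  have h1 : toLie v = 0 := by
    have := congrArg (· * (((g : (BMat n)ˣ)⁻¹ : (BMat n)ˣ) : BMat n)) h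
    simpa [mul_assoc] using this
  rw [toLie, neg_eq_zero, smul_eq_zero,
    or_iff_right (inv_ne_zero (hbar_ne_zero hn)), ← fromBlocks_zero, fromBlocks_inj] at h1
  obtain ⟨h2, -, h3, -⟩ := h1
  rw [h2, sub_zero] at h3
  exact Prod.ext (Subtype.ext h2) (Subtype.ext h3)

/-- A Jacobi field with vanishing coordinates grows linearly. -/
lemma isJacobiPair_eq_zero (hn : 2 ≤ n) {y z : ℝ → Alg n} {T : ℝ} (hT : T ≠ 0)
    (h : IsJacobiPair (fun _ => rot n) y z) (h0 : y 0 = 0) (hyT : y T = 0)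
    (hc : ∀ (i : Idx n) t, i.coord (y t) = 0) (t : ℝ) : y t = 0 := by
  -- Where the coordinates of y vanish identically, the first Jacobi equation forces those of z to
  -- vanish too.
  have hcz : ∀ (i : Idx n) t, i.coord (z t) = 0 := fun i t => by
    have h1 := (i.hasDerivAt_coord hn h t).1
    simp only [hc, mul_zero, zero_add] at h1
    exact h1.unique (hasDerivAt_const t 0)
  have hy : ∀ t, HasDerivAt y (z t) t := fun t => by
    obtain ⟨h1, h2⟩ := Idx.S₃_comm_eq_zero fun i => hc i t
    refine (h.1 t).congr_deriv ?_
    have : ad (rot n) (y t) = 0 := Prod.ext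
      (Subtype.ext (by rw [ad_rot_fst hn, h1, neg_zero]; rfl))
      (Subtype.ext (by rw [ad_rot_snd hn, h2, neg_zero]; rfl))
    rw [this, zero_add]
  have hz : ∀ t, HasDerivAt z 0 t := fun t => by
    obtain ⟨h1, h2⟩ := Idx.S₃_comm_eq_zero fun i => hcz i t
    obtain ⟨a, b, ha, hb, hz⟩ := h.2 t
    obtain ⟨a1, a2⟩ := (isAdStar_rot_left hn).1 ha
    obtain ⟨b1, b2⟩ := (isAdStar_rot_right hn).1 hb
    have hl : lap (0 : Mat n) = 0 := by simp [lap, comm]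
    rw [h1, hl] at a1
    rw [comm_add_right, h1, h2, add_zero] at b1
    rw [h2] at a2
    rw [h1, neg_zero] at b2
    have ha0 : a = 0 := Prod.ext (Subtype.ext (eq_zero_of_lap a.1.2.2 a1)) (Subtype.ext a2)
    have hb0 : b = 0 := Prod.ext (Subtype.ext (eq_zero_of_lap b.1.2.2 b1)) (Subtype.ext b2)
    refine hz.congr_deriv ?_
    rw [ha0, hb0, add_zero, neg_zero]
  have hzc : ∀ t, z t = z 0 := fun t => is_const_of_deriv_eq_zero
    (fun r => (hz r).differentiableAt) (fun r => (hz r).deriv) t 0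
  have hd : ∀ r, HasDerivAt (fun r => y r - r • z 0) 0 r := fun r => by
    refine ((hy r).sub ((hasDerivAt_id r).smul_const (z 0))).congr_deriv ?_
    rw [hzc r, one_smul, sub_self]
  have hyc : ∀ t, y t = t • z 0 := fun t => by
    have := is_const_of_deriv_eq_zero (fun r => (hd r).differentiableAt)
      (fun r => (hd r).deriv) t 0
    rw [h0, zero_smul, sub_zero] at this
    exact sub_eq_zero.1 this
  have : z 0 = 0 := by
    rw [hyc T] at hyT
    exact (smul_eq_zero.1 hyT).resolve_left hT
  rw [hyc t, this, smul_zero]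

lemma vanishingJacobi_mono (γ : ℝ → group n) (v : ℝ → Alg n) (T : ℝ)
    {K L : Submodule ℝ (Alg n)} (h : K ≤ L) :
    vanishingJacobi γ v T K ≤ vanishingJacobi γ v T L := by
  rintro J ⟨h0, hT, y, z, hyz, hK, hJ⟩
  exact ⟨h0, hT, y, z, hyz, fun t => h (hK t), hJ⟩

lemma exists_coord_of_mem (hn : 2 ≤ n) {γ : ℝ → group n} {T : ℝ} {y z : ℝ → Alg n}
    {J : ℝ → BMat n} (h0 : J 0 = 0) (hT : J T = 0) (hyz : IsJacobiPair (fun _ => rot n) y z)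
    (hJ : ∀ t, J t = toLie (y t) * ((γ t : (BMat n)ˣ) : BMat n)) (i : Idx n) :
    ∃ x : ℂ, x * i.profile T = 0 ∧ ∀ t, i.coord (y t) = x * i.profile t := by
  have h1 : y 0 = 0 := toLie_mul_eq_zero hn (γ 0) (by rw [← hJ, h0])
  have h2 : y T = 0 := toLie_mul_eq_zero hn (γ T) (by rw [← hJ, hT])
  obtain ⟨x, hx⟩ := i.exists_coord_eq hn hyz h1
  exact ⟨x, by rw [← hx, h2, map_zero], hx⟩

lemma exists_field_of_mem_blk (hn : 2 ≤ n) {γ : ℝ → group n} {T : ℝ} {J : ℝ → BMat n}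
    {i : Idx n} (hJ : J ∈ vanishingJacobi γ (fun _ => rot n) T i.blk) :
    ∃ x : ℂ, x * i.profile T = 0 ∧ J = i.field γ x := by
  obtain ⟨h0, hT, y, z, hyz, hK, hJ⟩ := hJ
  obtain ⟨x, hx, hy⟩ := exists_coord_of_mem hn h0 hT hyz hJ i
  refine ⟨x, hx, ?_⟩
  ext1 t
  rw [hJ, Idx.field_apply, ← hy, Idx.embed_coord (hK t)]

/-- Every Jacobi field that vanishes at the times `0` and `T` is a sum of such fields in the
blocks. -/
lemma exists_sum_field (hn : 2 ≤ n) {γ : ℝ → group n} {T : ℝ} (hT0 : T ≠ 0) {J : ℝ → BMat n}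
    (hJ : J ∈ vanishingJacobi γ (fun _ => rot n) T ⊤) :
    ∃ x : Idx n → ℂ, (∀ i, x i * i.profile T = 0) ∧ J = ∑ i : Idx n, i.field γ (x i) := by
  have hJ' := hJ
  obtain ⟨h0, hT, y, z, hyz, -, hy⟩ := hJ'
  choose x hx hxy using exists_coord_of_mem hn h0 hT hyz hy
  refine ⟨x, hx, ?_⟩
  -- The remainder after removing the block parts is again a vanishing Jacobi field; its coordinates
  -- are zero, so it grows linearly and must vanish.
  have hmem : J - ∑ i : Idx n, i.field γ (x i) ∈ vanishingJacobi γ (fun _ => rot n) T ⊤ :=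
    Submodule.sub_mem _ hJ (Submodule.sum_mem _ fun i _ =>
      vanishingJacobi_mono _ _ _ le_top (i.field_mem hn γ (hx i)))
  obtain ⟨h0', hT', y', z', hyz', -, hy'⟩ := hmem
  let L : Alg n →ₗ[ℝ] BMat n := ⟨⟨toLie, toLie_add⟩, toLie_smul⟩
  have hyy : ∀ t, y' t = y t - ∑ i : Idx n, i.embed (x i * i.profile t) := fun t => by
    refine sub_eq_zero.1 (toLie_mul_eq_zero hn (γ t) ?_)
    change L _ * _ = 0
    rw [map_sub, map_sub, map_sum, sub_mul, sub_mul, Finset.sum_mul]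
    change toLie (y' t) * _ - (toLie (y t) * _ -
      ∑ i : Idx n, toLie (i.embed (x i * i.profile t)) * _) = 0
    rw [← hy', ← hy, Pi.sub_apply, Finset.sum_apply]
    simp only [← Idx.field_apply]
    abel
  have hc : ∀ (j : Idx n) t, j.coord (y' t) = 0 := fun j t => by
    rw [hyy, map_sub, map_sum, Finset.sum_eq_single j
      (fun i _ hi => Idx.coord_of_mem_blk hi.symm (i.embed_mem _)) (by simp), Idx.coord_embed, hxy,
      sub_self]
  have hz := isJacobiPair_eq_zero hn hT0 hyz' (toLie_mul_eq_zero hn (γ 0) (by rw [← hy', h0']))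
    (toLie_mul_eq_zero hn (γ T) (by rw [← hy', hT'])) hc
  refine sub_eq_zero.1 (funext fun t => ?_)
  have hL : toLie (0 : Alg n) = 0 := map_zero L
  rw [hy', hz, hL, zero_mul]
  rfl

/-- Fields in different blocks are independent. -/
lemma field_eq_zero_of_sum (hn : 2 ≤ n) {γ : ℝ → group n} {x : Idx n → ℂ}
    (h : ∑ i : Idx n, i.field γ (x i) = 0) (i : Idx n) : i.field γ (x i) = 0 := by
  let L : Alg n →ₗ[ℝ] BMat n := ⟨⟨toLie, toLie_add⟩, toLie_smul⟩
  ext1 t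
  have h1 : ∑ j : Idx n, j.embed (x j * j.profile t) = 0 := by
    refine toLie_mul_eq_zero hn (γ t) ?_
    change L _ * _ = 0
    rw [map_sum, Finset.sum_mul]
    have := congrFun h t
    rwa [Finset.sum_apply] at this
  have h2 := congrArg i.coord h1
  rw [map_sum, map_zero, Finset.sum_eq_single i
    (fun j _ hj => Idx.coord_of_mem_blk hj.symm (j.embed_mem _)) (by simp), Idx.coord_embed] at h2
  have hL : toLie (0 : Alg n) = 0 := map_zero L
  rw [Idx.field_apply, h2, map_zero, hL, zero_mul]
  rfl

/-- Finiteness is what lets the dimension of the product of these spaces be computed as a sum of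
`finrank`s. -/
lemma finite_vanishingJacobi_blk (hn : 2 ≤ n) (γ : ℝ → group n) (T : ℝ) (i : Idx n) :
    Module.Finite ℝ (vanishingJacobi γ (fun _ => rot n) T i.blk) := by
  have h : vanishingJacobi γ (fun _ => rot n) T i.blk ≤ LinearMap.range (i.field γ) := by
    intro J hJ
    obtain ⟨x, -, rfl⟩ := exists_field_of_mem_blk hn hJ
    exact ⟨x, rfl⟩
  exact Submodule.finiteDimensional_of_le h

theorem multiplicity_eq_sum (hn : 2 ≤ n) (γ : ℝ → group n) {T : ℝ} (hT : T ≠ 0) :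
    multiplicity γ (fun _ => rot n) T = ∑ i : Idx n, multiplicityIn γ (fun _ => rot n) T i.blk := by
  have := finite_vanishingJacobi_blk hn γ T
  let Φ : (∀ i : Idx n, vanishingJacobi γ (fun _ => rot n) T i.blk) →ₗ[ℝ]
      vanishingJacobi γ (fun _ => rot n) T ⊤ :=
    ∑ i, Submodule.inclusion (vanishingJacobi_mono γ _ T le_top) ∘ₗ LinearMap.proj i
  have hΦ : ∀ J, (Φ J : ℝ → BMat n) = ∑ i, (J i : ℝ → BMat n) := fun J => by
    simp only [Φ, LinearMap.sum_apply, LinearMap.comp_apply, LinearMap.proj_apply,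
      AddSubmonoidClass.coe_finsetSum, Submodule.coe_inclusion]
  have hbij : Function.Bijective Φ := by
    constructor
    · rw [injective_iff_map_eq_zero]
      intro J hJ
      choose x hx hJx using fun i => exists_field_of_mem_blk hn (J i).2
      have h1 : ∑ i, (J i : ℝ → BMat n) = 0 := by rw [← hΦ, hJ]; rfl
      simp only [hJx] at h1
      ext1 i
      exact Subtype.ext ((hJx i).trans (field_eq_zero_of_sum hn h1 i))
    · rintro ⟨J, hJ⟩
      obtain ⟨x, hx, rfl⟩ := exists_sum_field hn hT hJ
      exact ⟨fun i => ⟨_, i.field_mem hn γ (hx i)⟩, Subtype.ext (hΦ _)⟩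
  rw [multiplicity, ← (LinearEquiv.ofBijective Φ hbij).finrank_eq, Module.finrank_pi_fintype]
  rfl

/-! ### The multiplicity of a single block -/

lemma Idx.profile_ne_zero (i : Idx n) : ∃ t, i.profile t ≠ 0 := by
  -- At this time the exponential exp(-imt/c) equals -1.
  refine ⟨Real.pi * i.const / i.ord, ?_⟩
  rw [Ne, i.profile_eq_zero_iff]
  have : -(Complex.I * i.ord / i.const) * ((Real.pi * i.const / i.ord : ℝ) : ℂ) =
      -(Real.pi * Complex.I) := by
    have h1 := i.ord_ne_zero
    have h2 := i.const_ne_zero'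
    push_cast
    field_simp
  rw [this, Complex.exp_neg, Complex.exp_pi_mul_I]
  norm_num

lemma Idx.field_injective (hn : 2 ≤ n) (i : Idx n) (γ : ℝ → group n) :
    Function.Injective (i.field γ) := by
  rw [injective_iff_map_eq_zero]
  intro x hx
  obtain ⟨t, ht⟩ := i.profile_ne_zero
  have h := congrArg i.coord (toLie_mul_eq_zero hn (γ t) (congrFun hx t))
  rw [coord_embed, map_zero] at h
  exact (mul_eq_zero.1 h).resolve_right ht

/-- When the profile vanishes at T every complex amplitude is allowed, so the space is a copy of ℂ.
-/
theorem multiplicityIn_blk (hn : 2 ≤ n) (γ : ℝ → group n) {T : ℝ} (i : Idx n)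
    (h : i.profile T = 0) : multiplicityIn γ (fun _ => rot n) T i.blk = 2 := by
  have e : vanishingJacobi γ (fun _ => rot n) T i.blk = LinearMap.range (i.field γ) := by
    refine le_antisymm (fun J hJ => ?_) ?_
    · obtain ⟨x, -, rfl⟩ := exists_field_of_mem_blk hn hJ
      exact ⟨x, rfl⟩
    · rintro _ ⟨x, rfl⟩
      exact i.field_mem hn γ (by rw [h, mul_zero])
  rw [multiplicityIn, e, LinearMap.finrank_range_of_inj (i.field_injective hn γ),
    Complex.finrank_real_complex]

theorem isConjugate_of_profile (hn : 2 ≤ n) (γ : ℝ → group n) {T : ℝ} (hT : 0 < T) (i : Idx n)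
    (h : i.profile T = 0) : IsConjugate γ (fun _ => rot n) T := by
  refine ⟨hT, i.field γ 1, vanishingJacobi_mono _ _ _ le_top
    (i.field_mem hn γ (by rw [h, mul_zero])), fun h0 => one_ne_zero (α := ℂ) ?_⟩
  exact i.field_injective hn γ (by rw [h0, map_zero])

theorem sum_idx (F : Submodule ℝ (Alg n) → ℕ) :
    ∑ i : Idx n, F i.blk = ∑ ℓ ∈ Finset.Icc 1 (n - 1), ∑ m ∈ Finset.Icc 1 ℓ,
      (F (block n ℓ m ℓ) + F (block n ℓ m (-(ℓ + 1)))) := by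
  rw [Fintype.sum_prod_type, Finset.sum_sigma' (Finset.Icc 1 (n - 1)) fun ℓ => Finset.Icc 1 ℓ]
  simp only [Fintype.sum_bool]
  exact Finset.sum_coe_sort ((Finset.Icc 1 (n - 1)).sigma fun ℓ => Finset.Icc 1 ℓ)
    fun p => F (block n p.1 p.2 p.1) + F (block n p.1 p.2 (-(p.1 + 1)))

/-! ### Existence of the geodesic -/

/-- The one-parameter group of diagonal unitary matrices generated by `-S₃`. -/
def diagFlow (n : ℕ) (t : ℝ) : Mat n :=
  diagonal fun a => Complex.exp (-(Complex.I * (label a : ℂ)) * t)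

lemma diagFlow_mul (t r : ℝ) : diagFlow n t * diagFlow n r = diagFlow n (t + r) := by
  rw [diagFlow, diagFlow, diagonal_mul_diagonal, diagFlow]
  congr 1
  ext a
  rw [← Complex.exp_add]
  congr 1
  push_cast; ring

lemma diagFlow_zero : diagFlow n 0 = 1 := by simp [diagFlow]

lemma diagFlow_star (t : ℝ) : star (diagFlow n t) = diagFlow n (-t) := by
  rw [diagFlow, star_eq_conjTranspose, diagonal_conjTranspose, diagFlow]
  congr 1
  ext a
  rw [Pi.star_apply, Complex.star_def, ← Complex.exp_conj]
  congr 1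
  simp

lemma diagFlow_mem (t : ℝ) : diagFlow n t ∈ specialUnitaryGroup (Fin n) ℂ := by
  rw [mem_specialUnitaryGroup_iff, mem_unitaryGroup_iff, diagFlow_star, diagFlow_mul]
  refine ⟨by rw [add_neg_cancel, diagFlow_zero], ?_⟩
  -- The determinant is 1 because the labels add up to zero.
  rw [diagFlow, det_diagonal, ← Complex.exp_sum, ← Finset.sum_mul, Finset.sum_neg_distrib,
    ← Finset.mul_sum, ← Complex.ofReal_sum, sum_label]
  simp

lemma hasDerivAt_diagFlow (t : ℝ) :
    HasDerivAt (diagFlow n) (-S₃ n * diagFlow n t) t := by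
  refine hasDerivAt_pi.2 fun a => hasDerivAt_pi.2 fun b => ?_
  rw [S₃, diagonal_neg, diagFlow, diagonal_mul_diagonal]
  by_cases hab : a = b
  · subst hab
    simp only [diagFlow, diagonal_apply_eq]
    exact hasDerivAt_cexp_mul _ t
  · simp only [diagFlow, diagonal_apply_ne _ hab]
    exact hasDerivAt_const t 0

/-- The geodesic with velocity field `rot n`. -/
def rotGeodesic (n : ℕ) (t : ℝ) : group n :=
  ⟨⟨fromBlocks (diagFlow n t) 0 0 (diagFlow n t),
    fromBlocks (diagFlow n (-t)) 0 0 (diagFlow n (-t)),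
    by simp [fromBlocks_multiply, diagFlow_mul, diagFlow_zero],
    by simp [fromBlocks_multiply, diagFlow_mul, diagFlow_zero]⟩,
    diagFlow n t, diagFlow_mem t, 0, zero_mem _, by simp⟩

lemma rotGeodesic_val (t : ℝ) : ((rotGeodesic n t : (BMat n)ˣ) : BMat n) =
    fromBlocks (diagFlow n t) 0 0 (diagFlow n t) := rfl

theorem isGeodesic_rotGeodesic (hn : 2 ≤ n) :
    IsGeodesic (rotGeodesic n) (fun _ => rot n) := by
  refine ⟨?_, fun t => ?_, fun t => ⟨0, ?_, ?_⟩⟩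
  · refine Subtype.ext (Units.ext ?_)
    rw [rotGeodesic_val, diagFlow_zero, fromBlocks_one]
    rfl
  -- Since P = B, the lower left block B - P is zero, and the factors of ℏ cancel.
  · have e : toLie (rot n) = fromBlocks (-S₃ n) 0 0 (-S₃ n) := by
      simp [toLie, rot, fromBlocks_smul, fromBlocks_neg, smul_smul, hbar_ne_zero hn]
    simp only [rotGeodesic_val, e, fromBlocks_multiply, zero_mul, mul_zero, add_zero, zero_add]
    have h : ∀ a b, HasDerivAt (fun r => diagFlow n r a b) ((-S₃ n * diagFlow n t) a b) t :=
      fun a b => hasDerivAt_pi.1 (hasDerivAt_pi.1 (hasDerivAt_diagFlow t) a) b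
    refine hasDerivAt_pi.2 fun a => hasDerivAt_pi.2 fun b => ?_
    rcases a with a | a <;> rcases b with b | b
    · exact h a b
    · exact hasDerivAt_const t 0
    · exact hasDerivAt_const t 0
    · exact h a b
  · have h0 : comm (S₃ n) (hbar n • S₃ n) = 0 := by simp [comm]
    refine (isAdStar_rot_left hn).2 ⟨?_, ?_⟩
    · change lap 0 = lap (comm (S₃ n) (hbar n • S₃ n))
      rw [h0]
    · exact h0.symm
  · rw [neg_zero]
    exact hasDerivAt_const t _

end Zeitlin
end

/-! ### The conjugate times and the total multiplicity -/

theorem mainTheorem4 (n : ℕ) (hn : 2 ≤ n) :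
    (∃ γ : ℝ → Zeitlin.group n, Zeitlin.IsGeodesic γ (fun _ => Zeitlin.rot n)) ∧
    ∀ γ : ℝ → Zeitlin.group n, Zeitlin.IsGeodesic γ (fun _ => Zeitlin.rot n) →
      (∀ ℓ m k : ℕ, 1 ≤ m → m ≤ ℓ → (ℓ : ℝ) ≤ ((n : ℝ) - 1) / 2 → 1 ≤ k →
        (Zeitlin.IsConjugate γ (fun _ => Zeitlin.rot n) (4 * Real.pi * k * ℓ / m) ∧
          Zeitlin.multiplicityIn γ (fun _ => Zeitlin.rot n) (4 * Real.pi * k * ℓ / m)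
            (Zeitlin.block n ℓ m ℓ) = 2) ∧
        (Zeitlin.IsConjugate γ (fun _ => Zeitlin.rot n) (4 * Real.pi * k * (ℓ + 1) / m) ∧
          Zeitlin.multiplicityIn γ (fun _ => Zeitlin.rot n) (4 * Real.pi * k * (ℓ + 1) / m)
            (Zeitlin.block n ℓ m (-(ℓ + 1))) = 2)) ∧
      ∀ T : ℝ, 0 < T →
        Zeitlin.multiplicity γ (fun _ => Zeitlin.rot n) T =
          ∑ ℓ ∈ Finset.Icc 1 (n - 1), ∑ m ∈ Finset.Icc 1 ℓ,
            (Zeitlin.multiplicityIn γ (fun _ => Zeitlin.rot n) T (Zeitlin.block n ℓ m ℓ) +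
              Zeitlin.multiplicityIn γ (fun _ => Zeitlin.rot n) T
                (Zeitlin.block n ℓ m (-(ℓ + 1)))) := by
  refine ⟨⟨_, Zeitlin.isGeodesic_rotGeodesic hn⟩, fun γ _ => ⟨?_, fun T hT => ?_⟩⟩
  · intro ℓ m k h1 h2 h3 hk
    have h2n : (2 : ℝ) ≤ n := by exact_mod_cast hn
    -- The bound on ℓ enters only through ℓ < n, which ensures that the harmonics are nonzero.
    have hℓ : ℓ < n := by
      have : (ℓ : ℝ) < n := by linarith
      exact_mod_cast this
    have hm : (0 : ℝ) < m := by exact_mod_cast h1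
    have hℓ0 : (0 : ℝ) < ℓ := by exact_mod_cast (by omega : 0 < ℓ)
    have hk0 : (0 : ℝ) < k := by exact_mod_cast hk
    have hpi := Real.pi_pos
    constructor
    · obtain ⟨i, rfl, rfl, hc⟩ := Zeitlin.Idx.exists_of_bounds h1 h2 hℓ true
      simp only [if_true] at hc
      have hp : i.profile (4 * Real.pi * k * i.deg / i.ord) = 0 := by
        rw [i.profile_eq_zero_iff, Complex.exp_eq_one_iff]
        -- With c = ℓ the exponent -imT/c at T = 4πkℓ/m is -2k times 2πi: these times are the even
        -- multiples of the first zero 2πℓ/m.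
        refine ⟨-(2 * k), ?_⟩
        have := i.ord_ne_zero
        have := i.const_ne_zero'
        rw [hc] at this ⊢
        push_cast at this ⊢
        field_simp
        ring
      refine ⟨Zeitlin.isConjugate_of_profile hn γ (by positivity) i hp, ?_⟩
      have := Zeitlin.multiplicityIn_blk hn γ i hp
      rwa [Zeitlin.Idx.blk, hc] at this
    · obtain ⟨i, rfl, rfl, hc⟩ := Zeitlin.Idx.exists_of_bounds h1 h2 hℓ false
      simp only [Bool.false_eq_true, if_false] at hc
      have hp : i.profile (4 * Real.pi * k * (i.deg + 1) / i.ord) = 0 := by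
        rw [i.profile_eq_zero_iff, Complex.exp_eq_one_iff]
        -- Here c = -(ℓ + 1) is negative, which reverses the sign of the winding number.
        refine ⟨2 * k, ?_⟩
        have := i.ord_ne_zero
        have h5 : (i.deg + 1 : ℂ) ≠ 0 := by exact_mod_cast Nat.succ_ne_zero i.deg
        rw [hc]
        push_cast
        rw [div_neg, neg_neg]
        field_simp
        ring
      refine ⟨Zeitlin.isConjugate_of_profile hn γ (by positivity) i hp, ?_⟩
      have := Zeitlin.multiplicityIn_blk hn γ i hp
      rwa [Zeitlin.Idx.blk, hc] at this
  · rw [Zeitlin.multiplicity_eq_sum hn γ hT.ne',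
      Zeitlin.sum_idx fun K => Zeitlin.multiplicityIn γ (fun _ => Zeitlin.rot n) T K]
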